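/- Let $n\ge 2$, $0\le k\le n$, $c=\pm1$ and $\varepsilon=\pm1$. Let $\mathbb{E}^{n+1}$ be $\mathbb{R}^{n+1}$ with the standard flat scalar product $g_o$ of index $k$ if $c=1$ and of index $k+1$ if $c=-1$, and let $\mathbb{M}^n_k(c)=\{p\in\mathbb{E}^{n+1}: g_o(p,p)=c\}$ with the induced metric (also denoted $g_o$), the semi-Riemannian space form $\mathbb{S}^n_k$ or $\mathbb{H}^n_k$. Let $I\subset\mathbb{R}$ be an open interval, let $a:I\to(0,\infty)$ be smooth, and let $\bar P^{n+1}=\varepsilon I\times_a\mathbb{M}^n_k(c)$ be the manifold $I\times\mathbb{M}^n_k(c)$ with the metric $\langle\,,\rangle=\varepsilon\,dt^2+a(t)^2g_o$ and Levi-Civita connection $\bar\nabla$. Let $M^n$ be an immersed hypersurface of $\bar P^{n+1}$ whose induced metric, also denoted $\langle\,,\rangle$, is non-degenerate, with Levi-Civita connection $\nabla$ and curvature $R(X,Y)Z=\nabla_X\nabla_YZ-\nabla_Y\nabla_XZ-\nabla_{[X,Y]}Z$, $R(X,Y,Z,W)=\langle R(X,Y)Z,W\rangle$. Let $e_{n+1}$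 be a smooth unit normal field along $M$, $\varepsilon_{n+1}=\langle e_{n+1},e_{n+1}\rangle=\pm1$, let $AX$ be the tangential part of $-\bar\nabla_Xe_{n+1}$ (the shape operator), let $T$ be the tangential part of $\partial_t$, and let $f=\varepsilon_{n+1}\langle\partial_t,e_{n+1}\rangle$. Below, $a$, $a'$, $a''$ are evaluated at the $I$-coordinate of the point of $M$, and $$\kappa=\frac{a''}{a}-\frac{(a')^2}{a^2}+\frac{\varepsilon c}{a^2}.$$ Then $\partial_t=T+f\,e_{n+1}$ along $M$, $\bar\nabla_Xe_{n+1}=-AX$ for every $X$ tangent to $M$, and for all $X,Y,Z,W$ tangent to $M$ the following hold. (1) (Gauss equation) $$\begin{aligned}R(X,Y,Z,W)={}&\Big(\varepsilon\frac{(a')^2}{a^2}-\frac{c}{a^2}\Big)\big(\langle X,Z\rangle\langle Y,W\rangle-\langle Y,Z\rangle\langle X,W\rangle\big)\\&+\kappa\big(\langle X,Z\rangle\langle Y,T\rangle\langle W,T\rangle-\langle Y,Z\rangle\langle X,T\rangle\langle W,T\rangle\\&\qquad-\langle X,W\rangle\langle Y,T\rangle\langle Z,T\rangle+\langle Y,W\rangle\langle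 X,T\rangle\langle Z,T\rangle\big)\\&+\varepsilon_{n+1}\big(\langle AY,Z\rangle\langle AX,W\rangle-\langle AY,W\rangle\langle AX,Z\rangle\big).\end{aligned}$$ (2) (Codazzi equation) $(\nabla_XA)Y-(\nabla_YA)X=\varepsilon_{n+1}f\kappa\,(\langle Y,T\rangle X-\langle X,T\rangle Y)$, where $(\nabla_XA)Y=\nabla_X(AY)-A(\nabla_XY)$. (3) $\bar\nabla_X\partial_t=\frac{a'}{a}(X-\varepsilon\langle X,T\rangle\partial_t)$. (4) $\nabla_XT=\frac{a'}{a}(X-\varepsilon\langle X,T\rangle T)+fAX$. (5) $X(f)=-\varepsilon_{n+1}\langle AT,X\rangle-\varepsilon\frac{a'}{a}\langle X,T\rangle f$. -/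

import Mathlib

open scoped Manifold ContDiff

noncomputable section

namespace WarpedHypersurface

/-! ### Scalar products on tangent bundles, Levi-Civita connection, curvature -/

section General

variable {E H F K : Type*}
  [NormedAddCommGroup E] [NormedSpace ℝ E] [TopologicalSpace H]
  [NormedAddCommGroup F] [NormedSpace ℝ F] [TopologicalSpace K]

/-- A field of bilinear forms on the tangent spaces of a manifold. -/
abbrev MetricField (I : ModelWithCorners ℝ E H) (M : Type*) [TopologicalSpace M]
    [ChartedSpace H M] : Type _ :=
  (x : M) → TangentSpace I x →L[ℝ] TangentSpace I x →L[ℝ] ℝ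

variable {I : ModelWithCorners ℝ E H} {J : ModelWithCorners ℝ F K}
  {M : Type*} [TopologicalSpace M] [ChartedSpace H M]
  {N : Type*} [TopologicalSpace N] [ChartedSpace K N]

/-- The pull-back `χ^* g`, that is `(u, v) ↦ g (dχ u, dχ v)`. -/
def pullbackMetric (I : ModelWithCorners ℝ E H) (g : MetricField J N) (χ : M → N) :
    MetricField I M := fun x =>
  ((mfderiv I J χ x).precomp ℝ).comp ((g (χ x)).comp (mfderiv I J χ x))

lemma pullbackMetric_apply (g : MetricField J N) (χ : M → N) (x : M) (u w : TangentSpace I x) :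
    pullbackMetric I g χ x u w = g (χ x) (mfderiv I J χ x u) (mfderiv I J χ x w) := rfl

/-- The constant field given by a bilinear form on a vector space. -/
def constMetric (b : F →L[ℝ] F →L[ℝ] ℝ) : MetricField 𝓘(ℝ, F) F := fun _ => b

/-- Non-degeneracy of the form on every tangent space. -/
def Nondegenerate (g : MetricField I M) : Prop :=
  ∀ x (u : TangentSpace I x), (∀ w, g x u w = 0) → u = 0

/-- The expression of `g` in the preferred chart `φ` of `N` at `p`, i.e. the pull-back of `g` by
`φ⁻¹`, as a function on the model vector space (relevant near `φ p`). -/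
def chartMetric (g : MetricField J N) (p : N) : F → F →L[ℝ] F →L[ℝ] ℝ :=
  pullbackMetric 𝓘(ℝ, F) g (extChartAt J p).symm

/-- The Christoffel symbols of `g` at `p` in the preferred chart at `p`, as a bilinear map:
with `G` the metric in the chart, `Γ(u, v)` is the vector such that
`G (Γ(u, v), w) = ½ (∂_u G (v, w) + ∂_v G (u, w) - ∂_w G (u, v))` for every `w`. -/
def christoffel (g : MetricField J N) (p : N) (u v : F) : F :=
  let z : F := extChartAt J p p
  let dG : F →L[ℝ] F →L[ℝ] F →L[ℝ] ℝ := fderiv ℝ (chartMetric g p) z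
  (chartMetric g p z).inverse ((1 / 2 : ℝ) • (dG u v + dG v u - (dG.flip u).flip v))

/-- The derivative `∇̄_v V` at `x`, in the direction `v ∈ T_x M`, of a vector field `V` along a
map `χ : M → N`, for the Levi-Civita connection `∇̄` of `g`. In the chart `φ` of `N` at `χ x`
it is `d(dφ V)(v) + Γ(dχ v, V)`; the differential of `φ` at the centre `χ x` is the identity. -/
def covDerivAlong (g : MetricField J N) (χ : M → N) (V : (y : M) → TangentSpace J (χ y)) (x : M)
    (v : TangentSpace I x) : TangentSpace J (χ x) :=
  (mvfderiv I (fun y => mvfderiv J (extChartAt J (χ x)) (χ y) (V y)) x v : F)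
    + christoffel g (χ x) (mfderiv I J χ x v) (V x)

/-- The Levi-Civita covariant derivative `∇_v Y` of a vector field `Y` at `x`, `v ∈ T_x M`. -/
def leviCivita (g : MetricField I M) (Y : (y : M) → TangentSpace I y) (x : M)
    (v : TangentSpace I x) : TangentSpace I x :=
  covDerivAlong (I := I) g (fun y : M => y) Y x v

/-- The curvature `R(X, Y) Z = ∇_X ∇_Y Z - ∇_Y ∇_X Z - ∇_{[X, Y]} Z`. -/
def curvature (g : MetricField I M) (X Y Z : (y : M) → TangentSpace I y) (x : M) :
    TangentSpace I x :=
  leviCivita g (fun y => leviCivita g Z y (Y y)) x (X x)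
    - leviCivita g (fun y => leviCivita g Z y (X y)) x (Y x)
    - leviCivita g Z x (VectorField.mlieBracket I X Y x)

/-- The covariant derivative `(∇_X B) Y = ∇_X (B Y) - B (∇_X Y)` of a field of endomorphisms. -/
def covDerivEnd (g : MetricField I M) (B : (y : M) → TangentSpace I y → TangentSpace I y)
    (X Y : (y : M) → TangentSpace I y) (x : M) : TangentSpace I x :=
  leviCivita g (fun y => B y (Y y)) x (X x) - B x (leviCivita g Y x (X x))

/-- Smoothness at `x` of a vector field `V` along the map `χ`. -/
def SmoothAlongAt [IsManifold J 1 N] (I : ModelWithCorners ℝ E H) (χ : M → N)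
    (V : (y : M) → TangentSpace J (χ y)) (x : M) : Prop :=
  ContMDiffAt I J.tangent ∞ (fun y => (⟨χ y, V y⟩ : TangentBundle J N)) x

/-- Smoothness at `x` of a vector field on `M`. -/
def SmoothFieldAt [IsManifold I 1 M] (X : (y : M) → TangentSpace I y) (x : M) : Prop :=
  SmoothAlongAt I (fun y : M => y) X x

/-- The tangential part of `w ∈ T_{χ x} N` along an immersion `χ` with non-degenerate induced
metric: the vector `u ∈ T_x M` such that `g (dχ u, dχ v) = g (w, dχ v)` for every `v`. -/
def tangentialPart (I : ModelWithCorners ℝ E H) (g : MetricField J N) (χ : M → N) (x : M)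
    (w : TangentSpace J (χ x)) : TangentSpace I x :=
  (pullbackMetric I g χ x).inverse ((g (χ x) w).comp (mfderiv I J χ x))

/-- The shape operator `A` associated with a unit normal field `ν` along `χ`:
`A v` is the tangential part of `-∇̄_v ν`. -/
def shapeOperator (I : ModelWithCorners ℝ E H) (g : MetricField J N) (χ : M → N)
    (ν : (y : M) → TangentSpace J (χ y)) (x : M) (v : TangentSpace I x) : TangentSpace I x :=
  tangentialPart I g χ x (-covDerivAlong g χ ν x v)

/-- `χ` is a smooth immersion and the metric induced by `g` is non-degenerate. -/
structure IsNondegenerateImmersion (I : ModelWithCorners ℝ E H) (g : MetricField J N)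
    (χ : M → N) : Prop where
  smooth : ContMDiff I J ∞ χ
  injective_mfderiv : ∀ x, Function.Injective (mfderiv I J χ x)
  nondegenerate : Nondegenerate (pullbackMetric I g χ)

/-- `ν` is a smooth normal vector field along `χ` with `g (ν, ν) = δ`. -/
structure IsUnitNormal [IsManifold J 1 N] (I : ModelWithCorners ℝ E H) (g : MetricField J N) (χ : M → N)
    (ν : (y : M) → TangentSpace J (χ y)) (δ : ℝ) : Prop where
  smooth : ∀ x, SmoothAlongAt I χ ν x
  normal : ∀ x (v : TangentSpace I x), g (χ x) (ν x) (mfderiv I J χ x v) = 0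
  unit : ∀ x, g (χ x) (ν x) (ν x) = δ

end General

/-! ### The space forms `𝕄ⁿ_k(c)`, `c = ±1`, as central quadrics -/

/-- The scalar product of index `q` on `ℝᵐ`: `- ∑_{i < q} x_i y_i + ∑_{i ≥ q} x_i y_i`. -/
def flatForm (m q : ℕ) :
    EuclideanSpace ℝ (Fin m) →L[ℝ] EuclideanSpace ℝ (Fin m) →L[ℝ] ℝ :=
  ∑ i : Fin m, (if (i : ℕ) < q then (-1 : ℝ) else 1) •
    (EuclideanSpace.proj i : EuclideanSpace ℝ (Fin m) →L[ℝ] ℝ).smulRight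
      (EuclideanSpace.proj i : EuclideanSpace ℝ (Fin m) →L[ℝ] ℝ)

lemma flatForm_apply (m q : ℕ) (x y : EuclideanSpace ℝ (Fin m)) :
    flatForm m q x y = ∑ i : Fin m, (if (i : ℕ) < q then (-1 : ℝ) else 1) * (x i * y i) := by
  simp only [flatForm, sum_apply, smul_apply, ContinuousLinearMap.smulRight_apply, smul_eq_mul,
    EuclideanSpace.coe_proj]

lemma flatForm_comm (m q : ℕ) (x y : EuclideanSpace ℝ (Fin m)) :
    flatForm m q x y = flatForm m q y x := by
  simp [flatForm_apply, mul_comm]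

/-- The sign `c = ±1` as a real number. -/
def signR (c : ℤˣ) : ℝ := ((c : ℤ) : ℝ)

lemma signR_mul_self (c : ℤˣ) : signR c * signR c = 1 := by
  rcases Int.units_eq_one_or c with rfl | rfl <;> simp [signR]

/-- The form `g_o` of the ambient space `𝔼ⁿ⁺¹`, which is `ℝⁿ⁺¹_k` for `c = 1` and
`ℝⁿ⁺¹_{k+1}` for `c = -1`. -/
abbrev ambientForm (n k : ℕ) (c : ℤˣ) :
    EuclideanSpace ℝ (Fin (n + 1)) →L[ℝ] EuclideanSpace ℝ (Fin (n + 1)) →L[ℝ] ℝ :=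
  flatForm (n + 1) (if c = 1 then k else k + 1)

/-- `𝕄ⁿ_k(c) = {p ∈ 𝔼ⁿ⁺¹ : g_o (p, p) = c}`: the pseudo-sphere `𝕊ⁿ_k` for `c = 1` and the
pseudo-hyperbolic space `ℍⁿ_k` for `c = -1`. -/
@[ext]
structure SpaceForm (n k : ℕ) (c : ℤˣ) : Type where
  /-- The inclusion into `𝔼ⁿ⁺¹`. -/
  incl : EuclideanSpace ℝ (Fin (n + 1))
  form_self : ambientForm n k c incl incl = signR c

namespace SpaceForm

variable {n k : ℕ} {c : ℤˣ}

/-- The subspace topology. -/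
instance : TopologicalSpace (SpaceForm n k c) := TopologicalSpace.induced incl inferInstance

lemma isInducing_incl : Topology.IsInducing (incl : SpaceForm n k c → _) := ⟨rfl⟩

lemma continuous_incl : Continuous (incl : SpaceForm n k c → _) := isInducing_incl.continuous

/-- The orthogonal complement of `p`. -/
abbrev perp (p : SpaceForm n k c) : Submodule ℝ (EuclideanSpace ℝ (Fin (n + 1))) :=
  LinearMap.ker (ambientForm n k c p.incl : EuclideanSpace ℝ (Fin (n + 1)) →ₗ[ℝ] ℝ)

lemma signR_ne_zero (c : ℤˣ) : signR c ≠ 0 := fun h => by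
  have := signR_mul_self c
  simp [h] at this

lemma finrank_perp (p : SpaceForm n k c) :
    Module.finrank ℝ p.perp = Module.finrank ℝ (EuclideanSpace ℝ (Fin n)) := by
  have h : (ambientForm n k c p.incl : EuclideanSpace ℝ (Fin (n + 1)) →ₗ[ℝ] ℝ) ≠ 0 := by
    intro h
    have := congrArg (fun l : EuclideanSpace ℝ (Fin (n + 1)) →ₗ[ℝ] ℝ => l p.incl) h
    exact signR_ne_zero c (p.form_self.symm.trans (by simpa using this))
  have := Module.Dual.finrank_ker_add_one_of_ne_zero h
  simp at this ⊢
  exact this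

/-- A linear isomorphism of the orthogonal complement of `p` with the model space `ℝⁿ`. -/
def perpEquiv (p : SpaceForm n k c) : p.perp ≃L[ℝ] EuclideanSpace ℝ (Fin n) :=
  ContinuousLinearEquiv.ofFinrankEq p.finrank_perp

/-- The orthogonal projection of `𝔼ⁿ⁺¹` onto the orthogonal complement of `p`. -/
def projPerp (p : SpaceForm n k c) : EuclideanSpace ℝ (Fin (n + 1)) →L[ℝ] p.perp :=
  (ContinuousLinearMap.id ℝ _ - (signR c • ambientForm n k c p.incl).smulRight p.incl).codRestrict
    p.perp (fun x => by
      have := signR_mul_self c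
      simp [p.form_self, mul_comm, ← mul_assoc, this])

/-- The projection of `𝔼ⁿ⁺¹` to the model space. -/
def toModel (p : SpaceForm n k c) :
    EuclideanSpace ℝ (Fin (n + 1)) →L[ℝ] EuclideanSpace ℝ (Fin n) :=
  (p.perpEquiv : p.perp →L[ℝ] EuclideanSpace ℝ (Fin n)).comp p.projPerp

/-- The inclusion of the model space into `𝔼ⁿ⁺¹` as the orthogonal complement of `p`. -/
def ofModel (p : SpaceForm n k c) :
    EuclideanSpace ℝ (Fin n) →L[ℝ] EuclideanSpace ℝ (Fin (n + 1)) :=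
  p.perp.subtypeL.comp (p.perpEquiv.symm : EuclideanSpace ℝ (Fin n) →L[ℝ] p.perp)

lemma form_ofModel (p : SpaceForm n k c) (y : EuclideanSpace ℝ (Fin n)) :
    ambientForm n k c p.incl (p.ofModel y) = 0 :=
  (p.perpEquiv.symm y).2

lemma ofModel_toModel (p : SpaceForm n k c) (x : EuclideanSpace ℝ (Fin (n + 1))) :
    p.ofModel (p.toModel x) = x - (signR c * ambientForm n k c p.incl x) • p.incl := by
  simp [ofModel, toModel, projPerp]

lemma toModel_add_smul (p : SpaceForm n k c) (y : EuclideanSpace ℝ (Fin n)) (s : ℝ) :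
    p.toModel (p.ofModel y + s • p.incl) = y := by
  have h : p.projPerp (p.ofModel y + s • p.incl) = p.perpEquiv.symm y := by
    apply Subtype.ext
    have h1 : signR c * signR c = 1 := signR_mul_self c
    have h2 : ((p.perpEquiv.symm y : p.perp) : EuclideanSpace ℝ (Fin (n + 1))) = p.ofModel y := rfl
    simp [projPerp, p.form_ofModel, p.form_self, h1, h2]
  simp [toModel, h]

/-- The radicand in the expression of the quadric as a graph over the orthogonal complement
of `p`. -/
def radicand (p : SpaceForm n k c) (y : EuclideanSpace ℝ (Fin n)) : ℝ :=
  1 - signR c * ambientForm n k c (p.ofModel y) (p.ofModel y)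

lemma continuous_radicand (p : SpaceForm n k c) : Continuous p.radicand := by
  unfold radicand
  fun_prop

/-- The graph map `y ↦ y + √(1 - c g_o (y, y)) p`. -/
def graphMap (p : SpaceForm n k c) (y : EuclideanSpace ℝ (Fin n)) :
    EuclideanSpace ℝ (Fin (n + 1)) :=
  p.ofModel y + √(p.radicand y) • p.incl

lemma graphMap_mem (p : SpaceForm n k c) {y : EuclideanSpace ℝ (Fin n)} (hy : 0 < p.radicand y) :
    ambientForm n k c (p.graphMap y) (p.graphMap y) = signR c := by
  have h1 := Real.mul_self_sqrt hy.le
  have h2 : ambientForm n k c (p.ofModel y) p.incl = 0 := by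
    rw [flatForm_comm]; exact p.form_ofModel y
  have h3 : ambientForm n k c (p.graphMap y) (p.graphMap y)
      = ambientForm n k c (p.ofModel y) (p.ofModel y)
        + √(p.radicand y) * √(p.radicand y) * signR c := by
    simp only [graphMap, map_add, map_smul, add_apply,
      smul_apply, p.form_ofModel, h2, p.form_self, smul_eq_mul]
    ring
  rw [h3, h1, radicand]
  have := signR_mul_self c
  linear_combination (-ambientForm n k c (p.ofModel y) (p.ofModel y)) * this

lemma radicand_toModel (p x : SpaceForm n k c) :
    p.radicand (p.toModel x.incl)
      = (signR c * ambientForm n k c p.incl x.incl) * (signR c * ambientForm n k c p.incl x.incl) := by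
  have h := flatForm_comm (n + 1) (if c = 1 then k else k + 1) x.incl p.incl
  have h1 := signR_mul_self c
  rw [radicand, ofModel_toModel]
  simp only [map_sub, map_smul, sub_apply, smul_apply,
    smul_eq_mul, x.form_self, p.form_self, h]
  linear_combination (-1 - signR c ^ 2 * (ambientForm n k c p.incl x.incl) ^ 2) * h1

open Classical in
/-- The chart at `p`: the orthogonal projection of the open half `{x : c g_o (p, x) > 0}` of the
quadric to the orthogonal complement of `p`, whose inverse is the graph map. -/
def chart (p : SpaceForm n k c) :
    OpenPartialHomeomorph (SpaceForm n k c) (EuclideanSpace ℝ (Fin n)) where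
  toFun x := p.toModel x.incl
  invFun y := if h : 0 < p.radicand y then ⟨p.graphMap y, p.graphMap_mem h⟩ else p
  source := {x | 0 < signR c * ambientForm n k c p.incl x.incl}
  target := {y | 0 < p.radicand y}
  map_source' x hx := by
    simp only [Set.mem_ofPred_eq] at hx ⊢
    rw [radicand_toModel]
    exact mul_pos hx hx
  map_target' y hy := by
    simp only [Set.mem_ofPred_eq] at hy ⊢
    rw [dif_pos hy]
    have : signR c * ambientForm n k c p.incl (p.graphMap y) = √(p.radicand y) := by
      simp only [graphMap, map_add, map_smul, p.form_ofModel, p.form_self, smul_eq_mul]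
      linear_combination √(p.radicand y) * signR_mul_self c
    exact lt_of_lt_of_eq (Real.sqrt_pos.2 hy) this.symm
  left_inv' x hx := by
    simp only [Set.mem_ofPred_eq] at hx
    have h := p.radicand_toModel x
    have hpos : 0 < p.radicand (p.toModel x.incl) := by rw [h]; exact mul_pos hx hx
    rw [dif_pos hpos]
    apply SpaceForm.ext
    change p.graphMap (p.toModel x.incl) = x.incl
    rw [graphMap, h, Real.sqrt_mul_self hx.le, ofModel_toModel]
    abel
  right_inv' y hy := by
    simp only [Set.mem_ofPred_eq] at hy
    rw [dif_pos hy]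
    exact p.toModel_add_smul y _
  continuousOn_toFun := (p.toModel.continuous.comp continuous_incl).continuousOn
  continuousOn_invFun := by
    rw [isInducing_incl.continuousOn_iff]
    have hc : Continuous p.graphMap := by
      unfold graphMap
      have := p.continuous_radicand
      fun_prop
    refine hc.continuousOn.congr fun y hy => ?_
    simp only [Set.mem_ofPred_eq] at hy
    simp only [Function.comp, dif_pos hy]
  open_source := isOpen_lt continuous_const (by
    have := continuous_incl (n := n) (k := k) (c := c)
    fun_prop)
  open_target := isOpen_lt continuous_const p.continuous_radicand

instance : ChartedSpace (EuclideanSpace ℝ (Fin n)) (SpaceForm n k c) where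
  atlas := Set.range chart
  chartAt := chart
  mem_chart_source p := by
    change 0 < signR c * ambientForm n k c p.incl p.incl
    rw [p.form_self, signR_mul_self]
    exact one_pos
  chart_mem_atlas p := ⟨p, rfl⟩

lemma incl_chart_symm (p : SpaceForm n k c) {y : EuclideanSpace ℝ (Fin n)}
    (hy : 0 < p.radicand y) : (p.chart.symm y).incl = p.graphMap y := by
  change incl (dite (0 < p.radicand y) _ _) = _
  rw [dif_pos hy]

lemma contDiffOn_graphMap (p : SpaceForm n k c) :
    ContDiffOn ℝ ω p.graphMap {y | 0 < p.radicand y} := by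
  intro y hy
  have hr : ContDiff ℝ ω p.radicand := by
    unfold radicand
    fun_prop
  have hs : ContDiffAt ℝ ω (fun y => √(p.radicand y)) y :=
    hr.contDiffAt.sqrt (ne_of_gt hy)
  exact (p.ofModel.contDiff.contDiffAt.add (hs.smul contDiffAt_const)).contDiffWithinAt

instance : IsManifold (𝓡 n) ω (SpaceForm n k c) := by
  apply isManifold_of_contDiffOn
  rintro _ _ ⟨p, rfl⟩ ⟨q, rfl⟩
  have h : ContDiffOn ℝ ω (fun y => q.toModel (p.graphMap y)) {y | 0 < p.radicand y} :=
    q.toModel.contDiff.comp_contDiffOn p.contDiffOn_graphMap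
  refine (h.mono ?_).congr ?_
  · intro y hy
    exact hy.1.1
  · intro y hy
    exact congrArg q.toModel (p.incl_chart_symm hy.1.1)

/-- The metric of `𝕄ⁿ_k(c)` induced by `g_o`. -/
def metric (n k : ℕ) (c : ℤˣ) : MetricField (𝓡 n) (SpaceForm n k c) :=
  pullbackMetric (𝓡 n) (constMetric (ambientForm n k c)) incl

end SpaceForm

/-! ### Warped products `ε I ×_a P` -/

section Warped

variable {F K : Type*} [NormedAddCommGroup F] [NormedSpace ℝ F] [TopologicalSpace K]
  {J : ModelWithCorners ℝ F K} {P : Type*} [TopologicalSpace P] [ChartedSpace K P]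

/-- The warped product metric `ε dt² + a(t)² g_P` on `I₀ × P`, with `I₀ ⊆ ℝ` open. -/
def warpedMetric (ε : ℝ) (I₀ : TopologicalSpace.Opens ℝ) (a : ℝ → ℝ) (gP : MetricField J P) :
    MetricField (𝓘(ℝ, ℝ).prod J) (I₀ × P) := fun p =>
  ε • pullbackMetric (𝓘(ℝ, ℝ).prod J) (constMetric (ContinuousLinearMap.mul ℝ ℝ))
      (fun q : I₀ × P => (q.1 : ℝ)) p
    + (a p.1) ^ 2 • pullbackMetric (𝓘(ℝ, ℝ).prod J) gP (fun q : I₀ × P => q.2) p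

/-- The vector field `∂_t` on `I₀ × P`. -/
def dt (J : ModelWithCorners ℝ F K) {I₀ : TopologicalSpace.Opens ℝ} (p : I₀ × P) :
    TangentSpace (𝓘(ℝ, ℝ).prod J) p :=
  ((1 : ℝ), (0 : F))

end Warped

end WarpedHypersurface

end

/-! The warped product embeds in `ℝ × 𝔼ⁿ⁺¹` by `toFlat`, with image in the quadric cylinder where `b
(p, p) = c`, and its metric is the pull-back of `G = ε dt² + a² b` (`warpedMetric_eq`). Vector
fields thus become functions with values in a fixed vector space, and the connection becomes an
ordinary derivative plus an explicit term of order zero: `flatCov` is `D_v V = dV(v) + Γ(dΦ v, V)`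
with `Γ = warpedGamma`. Paired with vectors tangent to the cylinder, `Γ` is the Koszul expression in
the derivative of `G` (`flatWarped_warpedGamma`); its multiple of the position vector keeps `D_v V`
tangent to the cylinder (`form_flatCov`). Hence `D` is compatible with `G` on tangent fields
(`mvfderiv_flatWarped`), has no torsion (`flatCov_mvfderiv_sub`), and its curvature is an algebraic
expression in `a`, `a'`, `a''` (`flatCov_flatCov_sub`, `flatWarped_warpedCurvature`).

The connection defined by Christoffel symbols is linked to this picture by `metric_covDerivAlong`,
valid for every metric pulled back from a normed space. Consequently `∇̄` along `χ` corresponds to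
`D` itself (`mvfderiv_toFlat_covDerivAlong`), and `∇` on `M` to the tangential part of `D`
(`metric_leviCivita`).

In the flat picture `M` has codimension two, with complement spanned by `ν` and the position vector.
Equalities between vectors tangent to the cylinder are therefore checked by pairing with `dΦ u` and
`ν` (`eq_zero_of_orthogonal`). This gives the Weingarten and Gauss formulas (`flatCov_normal`,
`flatCov_mvfderiv`). The Ricci identity for `D`, paired with tangent vectors, yields the Gauss
equation when applied to `dΦ Z` and the Codazzi equation when applied to `ν`. The field `∂_t`
becomes the constant `(1, 0)`, so `D ∂_t` can be read off `Γ`; differentiating `∂_t - f ν` and `δ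
⟨∂_t, ν⟩` gives the formulas for `∇T` and `df`.

The flat picture also handles iterated derivatives. The preferred chart changes with the base point,
so the regularity of `y ↦ ∇_Y Z` is awkward to see in charts; it is read off its image under `dΦ`
and pulled back by `mdifferentiableAt_principalPart`. -/

namespace WarpedHypersurface

set_option linter.unusedSectionVars false

/-! ### Calculus in preferred charts. -/

section ChartCalculus

variable {E H F K W : Type*}
  [NormedAddCommGroup E] [NormedSpace ℝ E] [TopologicalSpace H]
  [NormedAddCommGroup F] [NormedSpace ℝ F] [TopologicalSpace K]
  [NormedAddCommGroup W] [NormedSpace ℝ W]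
  {I : ModelWithCorners ℝ E H} {J : ModelWithCorners ℝ F K}
  {M : Type*} [TopologicalSpace M] [ChartedSpace H M]
  {N : Type*} [TopologicalSpace N] [ChartedSpace K N]

/-- The principal part, in the preferred chart at `χ x`, of a vector field along `χ`. -/
noncomputable def principalPart (J : ModelWithCorners ℝ F K) (χ : M → N)
    (V : (y : M) → TangentSpace J (χ y)) (x : M) : M → F :=
  fun y => mvfderiv J (extChartAt J (χ x)) (χ y) (V y)

/-- The expression of a vector-valued function in the preferred chart at `p`. -/
noncomputable def inChart (J : ModelWithCorners ℝ F K) (Φ : N → W) (p : N) : F → W :=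
  fun z => Φ ((extChartAt J p).symm z)

lemma mvfderiv_comp_of_hasFDerivAt {W' : Type*} [NormedAddCommGroup W'] [NormedSpace ℝ W']
    {h : M → W} {x : M} (hh : MDifferentiableAt I 𝓘(ℝ, W) h x) {f : W → W'} {f' : W →L[ℝ] W'}
    (hf : HasFDerivAt f f' (h x)) :
    MDifferentiableAt I 𝓘(ℝ, W') (fun y => f (h y)) x ∧
      ∀ v : TangentSpace I x, mvfderiv I (fun y => f (h y)) x v = f' (mvfderiv I h x v) := by
  have h1 : HasMFDerivAt I 𝓘(ℝ, W') (f ∘ h) x _ := hf.hasMFDerivAt.comp x hh.hasMFDerivAt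
  refine ⟨h1.mdifferentiableAt, fun v => ?_⟩
  exact congrArg (fun l : TangentSpace I x →L[ℝ] W' => l v) h1.mfderiv

lemma mvfderiv_prodMk {W' : Type*} [NormedAddCommGroup W'] [NormedSpace ℝ W']
    {h : M → W} {k : M → W'} {x : M} (hh : MDifferentiableAt I 𝓘(ℝ, W) h x)
    (hk : MDifferentiableAt I 𝓘(ℝ, W') k x) :
    MDifferentiableAt I 𝓘(ℝ, W × W') (fun y => (h y, k y)) x ∧
      ∀ v : TangentSpace I x, mvfderiv I (fun y => (h y, k y)) x v
        = (mvfderiv I h x v, mvfderiv I k x v) := by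
  have h1 : HasMFDerivAt I 𝓘(ℝ, W × W') (fun y => (h y, k y)) x _ :=
    ⟨hh.continuousAt.prodMk hk.continuousAt, hh.hasMFDerivAt.2.prodMk hk.hasMFDerivAt.2⟩
  refine ⟨h1.mdifferentiableAt, fun v => ?_⟩
  exact congrArg (fun l : TangentSpace I x →L[ℝ] W × W' => l v) h1.mfderiv

variable [J.Boundaryless] [IsManifold J 1 N]

lemma mvfderiv_extChartAt_self (p : N) (u : TangentSpace J p) :
    mvfderiv J (extChartAt J p) p u = u := by
  have := congrArg (fun l : TangentSpace J p →L[ℝ] F => l u) (mfderiv_extChartAt_self (I := J) (x := p))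
  exact this

lemma mvfderiv_extChartAt_comp {χ : M → N} {x : M} (hχ : MDifferentiableAt I J χ x) :
    MDifferentiableAt I 𝓘(ℝ, F) (fun y => extChartAt J (χ x) (χ y)) x ∧
      ∀ v : TangentSpace I x, mvfderiv I (fun y => extChartAt J (χ x) (χ y)) x v
        = mfderiv I J χ x v := by
  have h0 : MDifferentiableAt J 𝓘(ℝ, F) (extChartAt J (χ x)) (χ x) :=
    mdifferentiableAt_extChartAt (mem_chart_source K (χ x))
  refine ⟨h0.comp x hχ, fun v => ?_⟩
  exact (mfderiv_comp_apply x h0 hχ v).trans (mvfderiv_extChartAt_self (J := J) (χ x) _)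

lemma principalPart_self (χ : M → N) (V : (y : M) → TangentSpace J (χ y)) (x : M) :
    principalPart J χ V x x = V x :=
  mvfderiv_extChartAt_self _ _

lemma contDiffAt_inChart {m : WithTop ℕ∞} {Φ : N → W} {p : N}
    (hΦ : ContMDiffAt J 𝓘(ℝ, W) m Φ p) : ContDiffAt ℝ m (inChart J Φ p) (extChartAt J p p) := by
  have := (contMDiffAt_iff.1 hΦ).2
  rw [J.range_eq_univ, contDiffWithinAt_univ] at this
  exact this

lemma mdifferentiableAt_extChartAt_symm (p : N) {z : F} (hz : z ∈ (extChartAt J p).target) :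
    MDifferentiableAt 𝓘(ℝ, F) J (extChartAt J p).symm z := by
  have := mdifferentiableWithinAt_extChartAt_symm (I := J) hz
  rwa [J.range_eq_univ, mdifferentiableWithinAt_univ] at this

lemma mvfderiv_mfderiv_extChartAt_symm {Φ : N → W} (p : N) {z : F}
    (hz : z ∈ (extChartAt J p).target)
    (hΦ : MDifferentiableAt J 𝓘(ℝ, W) Φ ((extChartAt J p).symm z)) (u : F) :
    mvfderiv J Φ ((extChartAt J p).symm z) (mfderiv 𝓘(ℝ, F) J (extChartAt J p).symm z u)
      = fderiv ℝ (inChart J Φ p) z u := by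
  have h := mfderiv_comp_apply z hΦ (mdifferentiableAt_extChartAt_symm p hz) u
  have h2 : mfderiv 𝓘(ℝ, F) 𝓘(ℝ, W) (Φ ∘ (extChartAt J p).symm) z = fderiv ℝ (inChart J Φ p) z :=
    mfderiv_eq_fderiv
  rw [h2] at h
  exact h.symm

lemma mfderiv_extChartAt_symm_mvfderiv (p : N) {q : N} (hq : q ∈ (extChartAt J p).source)
    (u : TangentSpace J q) :
    (mfderiv 𝓘(ℝ, F) J (extChartAt J p).symm (extChartAt J p q)
      (mvfderiv J (extChartAt J p) q u) : F) = u := by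
  have h := mfderivWithin_extChartAt_symm_comp_mfderiv_extChartAt' (I := J) hq
  rw [J.range_eq_univ, mfderivWithin_univ] at h
  exact congrArg (fun l : TangentSpace J q →L[ℝ] TangentSpace J q => l u) h

/-- One fixed chart, centred at `p`, computes the differential at all nearby points `q`. This is
what allows `y ↦ dΦ (V y)` to be differentiated once more. -/
lemma mvfderiv_eq_fderiv_inChart {Φ : N → W} (p : N) {q : N}
    (hq : q ∈ (extChartAt J p).source) (hΦ : MDifferentiableAt J 𝓘(ℝ, W) Φ q)
    (u : TangentSpace J q) :
    mvfderiv J Φ q u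
      = fderiv ℝ (inChart J Φ p) (extChartAt J p q) (mvfderiv J (extChartAt J p) q u) := by
  have h0 := (extChartAt J p).left_inv hq
  have hΦ' : MDifferentiableAt J 𝓘(ℝ, W) Φ ((extChartAt J p).symm (extChartAt J p q)) := by
    rwa [h0]
  have := mvfderiv_mfderiv_extChartAt_symm p ((extChartAt J p).map_source hq) hΦ'
    (mvfderiv J (extChartAt J p) q u)
  rw [← this]
  have h1 := mfderiv_extChartAt_symm_mvfderiv p hq u
  -- The tangent space depends on the base point, so the change of base point is made on maps out of
  -- the common model space `F`.
  have h2 : ∀ q' : N, q' = q → (mvfderiv J Φ q : F → W) u = (mvfderiv J Φ q' : F → W) u := by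
    rintro _ rfl; rfl
  exact (h2 _ h0).trans (congrArg (mvfderiv J Φ _ : F → W) h1.symm)

lemma fderiv_inChart_self {Φ : N → W} {p : N} (hΦ : MDifferentiableAt J 𝓘(ℝ, W) Φ p)
    (u : TangentSpace J p) :
    fderiv ℝ (inChart J Φ p) (extChartAt J p p) u = mvfderiv J Φ p u :=
  ((mvfderiv_eq_fderiv_inChart p (mem_extChartAt_source p) hΦ u).trans
    (congrArg (fderiv ℝ (inChart J Φ p) (extChartAt J p p)) (mvfderiv_extChartAt_self p u))).symm

lemma inChart_self (Φ : N → W) (p : N) : inChart J Φ p (extChartAt J p p) = Φ p := by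
  rw [inChart, extChartAt_to_inv]

/-- The derivative of the vector-valued function `y ↦ dΦ (V y)`. -/
lemma hasMFDerivAt_mvfderiv_apply [IsManifold J 2 N] {Φ : N → W} {χ : M → N} {x : M}
    (hΦ : ContMDiffAt J 𝓘(ℝ, W) 2 Φ (χ x)) (hχ : MDifferentiableAt I J χ x) {V : (y : M) → TangentSpace J (χ y)}
    (hV : MDifferentiableAt I 𝓘(ℝ, F) (principalPart J χ V x) x) :
    MDifferentiableAt I 𝓘(ℝ, W) (fun y => mvfderiv J Φ (χ y) (V y)) x ∧
    ∀ v : TangentSpace I x, mvfderiv I (fun y => mvfderiv J Φ (χ y) (V y)) x v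
      = fderiv ℝ (fderiv ℝ (inChart J Φ (χ x))) (extChartAt J (χ x) (χ x))
          (mfderiv I J χ x v) (V x)
        + mvfderiv J Φ (χ x) (mvfderiv I (principalPart J χ V x) x v) := by
  set p := χ x with hp
  have hc := mvfderiv_extChartAt_comp hχ
  have hk := mvfderiv_prodMk hc.1 hV
  have hΨ : ContDiffAt ℝ 2 (inChart J Φ p) (extChartAt J p p) := contDiffAt_inChart hΦ
  have hΨ' : HasFDerivAt (fderiv ℝ (inChart J Φ p)) _ (extChartAt J p p) :=
    ((hΨ.fderiv_right (m := 1) le_rfl).differentiableAt one_ne_zero).hasFDerivAt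
  have hf : HasFDerivAt (fun w : F × F => fderiv ℝ (inChart J Φ p) w.1 w.2) _
      (extChartAt J p (χ x), principalPart J χ V x x) :=
    HasFDerivAt.clm_apply (HasFDerivAt.comp (g := fderiv ℝ (inChart J Φ p)) _ hΨ' hasFDerivAt_fst)
      hasFDerivAt_snd
  have hd := mvfderiv_comp_of_hasFDerivAt hk.1 hf
  -- Near `x` the function is the bilinear pairing of `D(Φ ∘ φ⁻¹)` at `φ (χ y)` with the principal
  -- part of `V`, so the product rule gives the two terms.
  have hev : (fun y => mvfderiv J Φ (χ y) (V y)) =ᶠ[nhds x]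
      fun y => fderiv ℝ (inChart J Φ p) (extChartAt J p (χ y)) (principalPart J χ V x y) := by
    have : ∀ᶠ y in nhds x, χ y ∈ (extChartAt J p).source :=
      hχ.continuousAt.eventually (extChartAt_source_mem_nhds p)
    have h1 : ∀ᶠ q in nhds p, ContMDiffAt J 𝓘(ℝ, W) 1 Φ q :=
      (contMDiffAt_iff_contMDiffAt_nhds (by simp)).1 (hΦ.of_le one_le_two)
    filter_upwards [this, hχ.continuousAt.eventually h1] with y hy hy1
    exact mvfderiv_eq_fderiv_inChart p hy (hy1.mdifferentiableAt one_ne_zero) _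
  refine ⟨hd.1.congr_of_eventuallyEq hev, fun v => ?_⟩
  have h1 : mvfderiv I (fun y => mvfderiv J Φ (χ y) (V y)) x v
      = mvfderiv I (fun y => fderiv ℝ (inChart J Φ p) (extChartAt J p (χ y))
          (principalPart J χ V x y)) x v :=
    congrArg (fun l : TangentSpace I x →L[ℝ] W => l v) hev.mfderiv_eq
  rw [h1, hd.2, hk.2, hc.2, principalPart_self]
  have h2 := fderiv_inChart_self (hΦ.mdifferentiableAt two_ne_zero)
    (mvfderiv I (principalPart J χ V x) x v)
  exact (add_comm _ _).trans (congrArg _ h2)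

/-- The bracket is defined by pulling the fields back to the chart, where they are the principal
parts; the differential of the chart at its centre is the identity, so no correction appears when
the result is carried back. -/
lemma lieBracket_eq_principalPart (X Y : (y : N) → TangentSpace J y) (x : N)
    [IsManifold J 2 N] [CompleteSpace F]
    (hX : MDifferentiableAt J 𝓘(ℝ, F) (principalPart J (fun y : N => y) X x) x)
    (hY : MDifferentiableAt J 𝓘(ℝ, F) (principalPart J (fun y : N => y) Y x) x) :
    (VectorField.mlieBracket J X Y x : F)
      = (mvfderiv J (principalPart J (fun y : N => y) Y x) x (X x) : F)
        - mvfderiv J (principalPart J (fun y : N => y) X x) x (Y x) := by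
  have key : ∀ Z : (y : N) → TangentSpace J y,
      VectorField.mpullbackWithin 𝓘(ℝ, F) J (extChartAt J x).symm Z (Set.range J)
        =ᶠ[nhds (extChartAt J x x)] inChart J (principalPart J (fun y : N => y) Z x) x := by
    intro Z
    have ht : (extChartAt J x).target ∈ nhds (extChartAt J x x) := extChartAt_target_mem_nhds x
    filter_upwards [ht] with z hz
    have h1 := mfderivWithin_extChartAt_symm_comp_mfderiv_extChartAt (I := J) hz
    have h2 := mfderiv_extChartAt_comp_mfderivWithin_extChartAt_symm (I := J) hz
    have h3 := ContinuousLinearMap.inverse_eq h1 h2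
    exact congrArg (fun l : TangentSpace J ((extChartAt J x).symm z) →L[ℝ] F =>
      l (Z ((extChartAt J x).symm z))) h3
  have hd : ∀ (Z : (y : N) → TangentSpace J y) (u : TangentSpace J x),
      MDifferentiableAt J 𝓘(ℝ, F) (principalPart J (fun y : N => y) Z x) x →
      fderiv ℝ (VectorField.mpullbackWithin 𝓘(ℝ, F) J (extChartAt J x).symm Z (Set.range J))
        (extChartAt J x x) u = mvfderiv J (principalPart J (fun y : N => y) Z x) x u := by
    intro Z u hZ
    have h := mvfderiv_eq_fderiv_inChart x (mem_extChartAt_source (I := J) x) hZ u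
    rw [mvfderiv_extChartAt_self] at h
    rw [h]
    exact congrArg (fun l : F →L[ℝ] F => l u) (key Z).fderiv_eq
  have h0 : ∀ Z : (y : N) → TangentSpace J y,
      VectorField.mpullbackWithin 𝓘(ℝ, F) J (extChartAt J x).symm Z (Set.range J)
        (extChartAt J x x) = Z x := fun Z => by
    rw [(key Z).self_of_nhds]
    change principalPart J (fun y : N => y) Z x ((extChartAt J x).symm (extChartAt J x x)) = _
    rw [extChartAt_to_inv]
    exact principalPart_self (fun y : N => y) Z x
  rw [← hd Y _ hY, ← hd X _ hX]
  have hinv : ∀ w : F, ((mfderiv J 𝓘(ℝ, F) (extChartAt J x) x).inverse w : F) = w := fun w => by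
    have := mfderiv_extChartAt_self (I := J) (x := x)
    exact (congrArg (fun l : F →L[ℝ] F => l.inverse w) this).trans
      (congrArg (fun l : F →L[ℝ] F => l w) ContinuousLinearMap.inverse_id)
  set VX : F → F := VectorField.mpullbackWithin 𝓘(ℝ, F) J (extChartAt J x).symm X (Set.range J)
    with hVX
  set VY : F → F := VectorField.mpullbackWithin 𝓘(ℝ, F) J (extChartAt J x).symm Y (Set.range J)
    with hVY
  have hset : (extChartAt J x).symm ⁻¹' Set.univ ∩ Set.range J = Set.univ := by
    rw [J.range_eq_univ, Set.preimage_univ, Set.univ_inter]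
  have h1 : (VectorField.mlieBracket J X Y x : F)
      = VectorField.lieBracketWithin ℝ VX VY Set.univ (extChartAt J x x) :=
    (hinv _).trans (congrArg
      (fun s => VectorField.lieBracketWithin ℝ VX VY s (extChartAt J x x)) hset)
  rw [h1, VectorField.lieBracketWithin_univ, VectorField.lieBracket]
  exact congrArg₂ (fun u w : F => fderiv ℝ VY (extChartAt J x x) u
    - fderiv ℝ VX (extChartAt J x x) w) (h0 X) (h0 Y)

/-- The commutator of two vector fields, acting on vector-valued functions. -/
lemma mvfderiv_mvfderiv_sub [IsManifold J 2 N] [CompleteSpace F]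
    {Φ : N → W} {X Y : (y : N) → TangentSpace J y} {x : N} (hΦ : ContMDiffAt J 𝓘(ℝ, W) 2 Φ x)
    (hX : MDifferentiableAt J 𝓘(ℝ, F) (principalPart J (fun y : N => y) X x) x)
    (hY : MDifferentiableAt J 𝓘(ℝ, F) (principalPart J (fun y : N => y) Y x) x) :
    mvfderiv J (fun y => mvfderiv J Φ y (Y y)) x (X x)
        - mvfderiv J (fun y => mvfderiv J Φ y (X y)) x (Y x)
      = mvfderiv J Φ x (VectorField.mlieBracket J X Y x) := by
  have hid : MDifferentiableAt J J (fun y : N => y) x := mdifferentiableAt_id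
  have hidd : ∀ u : TangentSpace J x, mfderiv J J (fun y : N => y) x u = u := fun u => by
    have : mfderiv J J (fun y : N => y) x = ContinuousLinearMap.id ℝ _ := mfderiv_id
    rw [this]; rfl
  have h1 := (hasMFDerivAt_mvfderiv_apply (χ := fun y : N => y) hΦ hid hY).2 (X x)
  have h2 := (hasMFDerivAt_mvfderiv_apply (χ := fun y : N => y) hΦ hid hX).2 (Y x)
  have hΨ : ContDiffAt ℝ 2 (inChart J Φ x) (extChartAt J x x) := contDiffAt_inChart hΦ
  have hs := (hΨ.isSymmSndFDerivAt (by simp)) (X x) (Y x)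
  -- The second derivatives of `Φ` cancel by symmetry; only the derivatives of the principal parts
  -- survive.
  erw [lieBracket_eq_principalPart X Y x hX hY]
  rw [h1, h2, hidd, hidd]
  erw [hs, map_sub]
  abel

end ChartCalculus

/-! ### The Levi-Civita connection of a metric pulled back from a normed space. -/

section PullbackConnection

variable {E H F K W : Type*}
  [NormedAddCommGroup E] [NormedSpace ℝ E] [TopologicalSpace H]
  [NormedAddCommGroup F] [NormedSpace ℝ F] [TopologicalSpace K]
  [NormedAddCommGroup W] [NormedSpace ℝ W]
  {I : ModelWithCorners ℝ E H} {J : ModelWithCorners ℝ F K}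
  {M : Type*} [TopologicalSpace M] [ChartedSpace H M]
  {N : Type*} [TopologicalSpace N] [ChartedSpace K N]
  [J.Boundaryless] [IsManifold J 1 N] [IsManifold J 2 N]
  {Φ : N → W} {G : W → W →L[ℝ] W →L[ℝ] ℝ} {g : MetricField J N}

/-- The pull-back of `G` by a map between normed spaces. -/
noncomputable def flatPullback (G : W → W →L[ℝ] W →L[ℝ] ℝ) (Ψ : F → W) (z : F) :
    F →L[ℝ] F →L[ℝ] ℝ :=
  ((ContinuousLinearMap.compL ℝ F W ℝ).flip (fderiv ℝ Ψ z)).comp ((G (Ψ z)).comp (fderiv ℝ Ψ z))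

lemma flatPullback_apply (Ψ : F → W) (z u w : F) :
    flatPullback G Ψ z u w = G (Ψ z) (fderiv ℝ Ψ z u) (fderiv ℝ Ψ z w) := rfl

lemma differentiableAt_flatPullback {Ψ : F → W} {z : F} (hΨ : ContDiffAt ℝ 2 Ψ z)
    (hG : DifferentiableAt ℝ G (Ψ z)) : DifferentiableAt ℝ (flatPullback G Ψ) z := by
  have h1 : DifferentiableAt ℝ Ψ z := hΨ.differentiableAt two_ne_zero
  have h2 : DifferentiableAt ℝ (fderiv ℝ Ψ) z :=
    (hΨ.fderiv_right (m := 1) le_rfl).differentiableAt one_ne_zero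
  have h3 : DifferentiableAt ℝ (fun z => G (Ψ z)) z := DifferentiableAt.comp (g := G) z hG h1
  have h4 : DifferentiableAt ℝ
      (fun z => (ContinuousLinearMap.compL ℝ F W ℝ).flip (fderiv ℝ Ψ z)) z :=
    DifferentiableAt.comp (g := (ContinuousLinearMap.compL ℝ F W ℝ).flip) z
      (ContinuousLinearMap.differentiableAt _) h2
  exact h4.clm_comp (h3.clm_comp h2)

lemma fderiv_flatPullback {Ψ : F → W} {z : F} (hΨ : ContDiffAt ℝ 2 Ψ z)
    {G' : W →L[ℝ] W →L[ℝ] W →L[ℝ] ℝ} (hG : HasFDerivAt G G' (Ψ z)) (u v w : F) :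
    fderiv ℝ (flatPullback G Ψ) z u v w
      = G' (fderiv ℝ Ψ z u) (fderiv ℝ Ψ z v) (fderiv ℝ Ψ z w)
        + G (Ψ z) (fderiv ℝ (fderiv ℝ Ψ) z u v) (fderiv ℝ Ψ z w)
        + G (Ψ z) (fderiv ℝ Ψ z v) (fderiv ℝ (fderiv ℝ Ψ) z u w) := by
  have h1 : HasFDerivAt Ψ (fderiv ℝ Ψ z) z := (hΨ.differentiableAt two_ne_zero).hasFDerivAt
  have h2 : HasFDerivAt (fderiv ℝ Ψ) (fderiv ℝ (fderiv ℝ Ψ) z) z :=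
    ((hΨ.fderiv_right (m := 1) le_rfl).differentiableAt one_ne_zero).hasFDerivAt
  have h3 : HasFDerivAt (fun z => G (Ψ z)) _ z := HasFDerivAt.comp (g := G) z hG h1
  have h4 := (h3.clm_apply (h2.clm_apply (hasFDerivAt_const v z))).clm_apply
    (h2.clm_apply (hasFDerivAt_const w z))
  have h5 := (differentiableAt_flatPullback hΨ hG.differentiableAt).hasFDerivAt
  have h6 := (h5.clm_apply (hasFDerivAt_const v z)).clm_apply (hasFDerivAt_const w z)
  have h7 := congrArg (fun l : F →L[ℝ] ℝ => l u) (h6.unique h4)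
  simp at h7
  linear_combination h7

/-- Equality on a neighbourhood is needed because the Christoffel symbols involve the derivative of
the metric in the chart. -/
lemma chartMetric_eventuallyEq (hΦ : ContMDiff J 𝓘(ℝ, W) 2 Φ)
    (hg : ∀ q u w, g q u w = G (Φ q) (mvfderiv J Φ q u) (mvfderiv J Φ q w)) (p : N) :
    chartMetric g p =ᶠ[nhds (extChartAt J p p)] flatPullback G (inChart J Φ p) := by
  filter_upwards [extChartAt_target_mem_nhds (I := J) p] with z hz
  ext u w
  have hd := (hΦ ((extChartAt J p).symm z)).mdifferentiableAt two_ne_zero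
  have h1 := mvfderiv_mfderiv_extChartAt_symm p hz hd u
  have h2 := mvfderiv_mfderiv_extChartAt_symm p hz hd w
  rw [flatPullback_apply, ← h1, ← h2]
  exact hg _ _ _

lemma chartMetric_self (hΦ : ContMDiff J 𝓘(ℝ, W) 2 Φ)
    (hg : ∀ q u w, g q u w = G (Φ q) (mvfderiv J Φ q u) (mvfderiv J Φ q w)) (p : N) (u w : F) :
    chartMetric g p (extChartAt J p p) u w = (g p : F → F →L[ℝ] ℝ) u w := by
  rw [(chartMetric_eventuallyEq hΦ hg p).self_of_nhds, flatPullback_apply]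
  have hd := (hΦ p).mdifferentiableAt two_ne_zero
  have h1 := fun u : F => fderiv_inChart_self (J := J) hd u
  rw [h1, h1, inChart_self]
  exact (hg p _ _).symm

/-- An injective map to a dual of the same finite dimension is bijective. Since
`ContinuousLinearMap.inverse` is zero on maps that are not invertible, this is what gives
`christoffel` and `tangentialPart` their intended meaning. -/
lemma isInvertible_of_nondegenerate [FiniteDimensional ℝ F] {b : F →L[ℝ] F →L[ℝ] ℝ}
    (hb : ∀ u, (∀ w, b u w = 0) → u = 0) : b.IsInvertible := by
  have hinj : Function.Injective b := by
    refine (injective_iff_map_eq_zero b).2 fun u hu => hb u fun w => ?_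
    rw [hu]; rfl
  let e : F ≃ₗ[ℝ] (F →L[ℝ] ℝ) := LinearEquiv.ofInjectiveOfFinrankEq b.toLinearMap hinj (by
    rw [← Subspace.dual_finrank_eq (K := ℝ) (V := F)]
    exact (LinearMap.toContinuousLinearMap (𝕜 := ℝ) (E := F) (F' := ℝ)).finrank_eq)
  exact ⟨e.toContinuousLinearEquiv, by ext; rfl⟩

lemma isInvertible_chartMetric [FiniteDimensional ℝ F] (hΦ : ContMDiff J 𝓘(ℝ, W) 2 Φ)
    (hg : ∀ q u w, g q u w = G (Φ q) (mvfderiv J Φ q u) (mvfderiv J Φ q w)) {p : N}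
    (hnd : ∀ u : TangentSpace J p, (∀ w, g p u w = 0) → u = 0) :
    (chartMetric g p (extChartAt J p p)).IsInvertible :=
  isInvertible_of_nondegenerate fun u hu => hnd u fun w =>
    (chartMetric_self hΦ hg p u w).symm.trans (hu w)

/-- The Koszul expression splits into the second derivative of the map and the Koszul expression of
`G` in the flat space. -/
lemma chartMetric_christoffel [FiniteDimensional ℝ F] (hΦ : ContMDiff J 𝓘(ℝ, W) 2 Φ)
    (hg : ∀ q u w, g q u w = G (Φ q) (mvfderiv J Φ q u) (mvfderiv J Φ q w)) {p : N}
    {G' : W →L[ℝ] W →L[ℝ] W →L[ℝ] ℝ} (hG : HasFDerivAt G G' (Φ p))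
    (hsymm : ∀ u w, G (Φ p) u w = G (Φ p) w u)
    (hnd : ∀ u : TangentSpace J p, (∀ w, g p u w = 0) → u = 0) (u v w : F) :
    chartMetric g p (extChartAt J p p) (christoffel g p u v) w
      = G (Φ p) (fderiv ℝ (fderiv ℝ (inChart J Φ p)) (extChartAt J p p) u v)
          ((mvfderiv J Φ p : F → W) w)
        + (1 / 2) * (G' ((mvfderiv J Φ p : F → W) u) ((mvfderiv J Φ p : F → W) v)
              ((mvfderiv J Φ p : F → W) w)
            + G' ((mvfderiv J Φ p : F → W) v) ((mvfderiv J Φ p : F → W) u)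
              ((mvfderiv J Φ p : F → W) w)
            - G' ((mvfderiv J Φ p : F → W) w) ((mvfderiv J Φ p : F → W) u)
              ((mvfderiv J Φ p : F → W) v)) := by
  have hd := (hΦ p).mdifferentiableAt two_ne_zero
  have hΨ : ContDiffAt ℝ 2 (inChart J Φ p) (extChartAt J p p) := contDiffAt_inChart (hΦ p)
  have hG' : HasFDerivAt G G' (inChart J Φ p (extChartAt J p p)) := by rwa [inChart_self]
  have h1 := fun u : F => fderiv_inChart_self (J := J) hd u
  have hsym := hΨ.isSymmSndFDerivAt (by simp)
  have hΓ : chartMetric g p (extChartAt J p p) (christoffel g p u v) w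
      = (1 / 2) * (fderiv ℝ (chartMetric g p) (extChartAt J p p) u v w
        + fderiv ℝ (chartMetric g p) (extChartAt J p p) v u w
        - fderiv ℝ (chartMetric g p) (extChartAt J p p) w u v) := by
    have := (isInvertible_chartMetric hΦ hg hnd).self_apply_inverse
      ((1 / 2 : ℝ) • (fderiv ℝ (chartMetric g p) (extChartAt J p p) u v
      + fderiv ℝ (chartMetric g p) (extChartAt J p p) v u
      - ((fderiv ℝ (chartMetric g p) (extChartAt J p p)).flip u).flip v))
    exact congrArg (fun l : F →L[ℝ] ℝ => l w) this
  rw [hΓ, (chartMetric_eventuallyEq hΦ hg p).fderiv_eq]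
  simp only [fderiv_flatPullback hΨ hG', h1, inChart_self]
  -- Of the six terms with a second derivative, those in `(u, w)` and `(v, w)` cancel, while the one
  -- in `(u, v)` occurs twice and absorbs the factor `1/2`.
  rw [hsym v u, hsym w u, hsym w v, hsymm _ (fderiv ℝ (fderiv ℝ (inChart J Φ p)) _ u w),
    hsymm _ (fderiv ℝ (fderiv ℝ (inChart J Φ p)) _ v w)]
  ring

/-- The Levi-Civita connection of a pulled back metric along a map, tested against a tangent
vector. -/
lemma metric_covDerivAlong [FiniteDimensional ℝ F] (hΦ : ContMDiff J 𝓘(ℝ, W) 2 Φ)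
    (hg : ∀ q u w, g q u w = G (Φ q) (mvfderiv J Φ q u) (mvfderiv J Φ q w))
    {χ : M → N} {x : M} (hχ : MDifferentiableAt I J χ x) {V : (y : M) → TangentSpace J (χ y)}
    (hV : MDifferentiableAt I 𝓘(ℝ, F) (principalPart J χ V x) x)
    {G' : W →L[ℝ] W →L[ℝ] W →L[ℝ] ℝ} (hG : HasFDerivAt G G' (Φ (χ x)))
    (hsymm : ∀ u w, G (Φ (χ x)) u w = G (Φ (χ x)) w u)
    (hnd : ∀ u : TangentSpace J (χ x), (∀ w, g (χ x) u w = 0) → u = 0)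
    (v : TangentSpace I x) (w : TangentSpace J (χ x)) :
    g (χ x) (covDerivAlong g χ V x v) w
      = G (Φ (χ x)) (mvfderiv I (fun y => mvfderiv J Φ (χ y) (V y)) x v) (mvfderiv J Φ (χ x) w)
        + (1 / 2) * (G' (mvfderiv J Φ (χ x) (mfderiv I J χ x v)) (mvfderiv J Φ (χ x) (V x))
              (mvfderiv J Φ (χ x) w)
            + G' (mvfderiv J Φ (χ x) (V x)) (mvfderiv J Φ (χ x) (mfderiv I J χ x v))
              (mvfderiv J Φ (χ x) w)
            - G' (mvfderiv J Φ (χ x) w) (mvfderiv J Φ (χ x) (mfderiv I J χ x v))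
              (mvfderiv J Φ (χ x) (V x))) := by
  have hcov := (hasMFDerivAt_mvfderiv_apply (hΦ _) hχ hV).2 v
  have h1 : g (χ x) (covDerivAlong g χ V x v) w
      = chartMetric g (χ x) (extChartAt J (χ x) (χ x)) (mvfderiv I (principalPart J χ V x) x v) w
        + chartMetric g (χ x) (extChartAt J (χ x) (χ x))
          (christoffel g (χ x) (mfderiv I J χ x v) (V x)) w :=
    (chartMetric_self hΦ hg (χ x) _ w).symm.trans
      (congrArg (fun l : F →L[ℝ] ℝ => l w)
        (map_add (chartMetric g (χ x) (extChartAt J (χ x) (χ x))) _ _))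
  have h2 : chartMetric g (χ x) (extChartAt J (χ x) (χ x))
        (mvfderiv I (principalPart J χ V x) x v) w
      = G (Φ (χ x)) (mvfderiv J Φ (χ x) (mvfderiv I (principalPart J χ V x) x v))
          (mvfderiv J Φ (χ x) w) :=
    (chartMetric_self hΦ hg (χ x) _ w).trans (hg (χ x) _ _)
  have h3 := chartMetric_christoffel hΦ hg hG hsymm hnd (mfderiv I J χ x v) (V x) w
  -- The second derivative in the Christoffel term is exactly the one in the derivative of `dΦ (V
  -- y)`, so the chart disappears from the formula.
  rw [h1, h2, hcov, h3, map_add, add_apply]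
  ring

/-- The map is the `G`-orthogonal projection to the tangent space, written in the chart. It inverts
`dΨ` on its image, which is how a field is recovered from its flat image. -/
lemma differentiableAt_inverse_flatPullback [FiniteDimensional ℝ F] {Ψ : F → W} {z : F}
    (hΨ : ContDiffAt ℝ 2 Ψ z) (hG : DifferentiableAt ℝ G (Ψ z))
    (hQ : (flatPullback G Ψ z).IsInvertible) (w₀ : W) :
    DifferentiableAt ℝ (fun w : F × W =>
      (flatPullback G Ψ w.1).inverse ((G (Ψ w.1) w.2).comp (fderiv ℝ Ψ w.1))) (z, w₀) := by
  have hfst : DifferentiableAt ℝ (Prod.fst : F × W → F) (z, w₀) := differentiableAt_fst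
  have h0 : DifferentiableAt ℝ (fun w : F × W => flatPullback G Ψ w.1) (z, w₀) :=
    DifferentiableAt.comp (g := flatPullback G Ψ) _ (differentiableAt_flatPullback hΨ hG) hfst
  have h1 : DifferentiableAt ℝ (fun w : F × W => (flatPullback G Ψ w.1).inverse) (z, w₀) :=
    DifferentiableAt.comp (g := ContinuousLinearMap.inverse)
      (f := fun w : F × W => flatPullback G Ψ w.1) (z, w₀)
      ((hQ.contDiffAt_map_inverse (n := 1)).differentiableAt one_ne_zero) h0
  have h2 : DifferentiableAt ℝ (fun w : F × W => G (Ψ w.1)) (z, w₀) :=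
    DifferentiableAt.comp (g := G) (f := fun w : F × W => Ψ w.1) (z, w₀) hG
      (DifferentiableAt.comp (g := Ψ) _ (hΨ.differentiableAt two_ne_zero) hfst)
  have h3 : DifferentiableAt ℝ (fun w : F × W => fderiv ℝ Ψ w.1) (z, w₀) :=
    DifferentiableAt.comp (g := fderiv ℝ Ψ) _
      ((hΨ.fderiv_right (m := 1) le_rfl).differentiableAt one_ne_zero) hfst
  exact h1.clm_apply ((h2.clm_apply differentiableAt_snd).clm_comp h3)

/-- A vector field is differentiable as soon as its image in the flat space is. -/
lemma mdifferentiableAt_principalPart [FiniteDimensional ℝ F] (hΦ : ContMDiff J 𝓘(ℝ, W) 2 Φ)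
    (hg : ∀ q u w, g q u w = G (Φ q) (mvfderiv J Φ q u) (mvfderiv J Φ q w)) {x : N}
    (hG : DifferentiableAt ℝ G (Φ x))
    (hnd : ∀ u : TangentSpace J x, (∀ w, g x u w = 0) → u = 0)
    {Y : (y : N) → TangentSpace J y}
    (hY : MDifferentiableAt J 𝓘(ℝ, W) (fun y => mvfderiv J Φ y (Y y)) x) :
    MDifferentiableAt J 𝓘(ℝ, F) (principalPart J (fun y : N => y) Y x) x := by
  have hΨ : ContDiffAt ℝ 2 (inChart J Φ x) (extChartAt J x x) := contDiffAt_inChart (hΦ x)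
  have hG' : DifferentiableAt ℝ G (inChart J Φ x (extChartAt J x x)) := by rwa [inChart_self]
  have hinv := isInvertible_chartMetric hΦ hg hnd
  have hQ : (flatPullback G (inChart J Φ x) (extChartAt J x x)).IsInvertible := by
    rwa [← (chartMetric_eventuallyEq hΦ hg x).self_of_nhds]
  have hQd := differentiableAt_flatPullback hΨ hG'
  have hid : MDifferentiableAt J J (fun y : N => y) x := mdifferentiableAt_id
  have hc := mvfderiv_extChartAt_comp hid
  have hk := (mvfderiv_prodMk hc.1 hY).1
  have hf := differentiableAt_inverse_flatPullback hΨ hG' hQ (mvfderiv J Φ x (Y x))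
  have hcomp := (mvfderiv_comp_of_hasFDerivAt hk hf.hasFDerivAt).1
  refine hcomp.congr_of_eventuallyEq ?_
  -- Invertibility is an open condition, so non-degeneracy at `x` suffices.
  have hopen : ∀ᶠ z in nhds (extChartAt J x x), (flatPullback G (inChart J Φ x) z).IsInvertible := by
    obtain ⟨e, he⟩ := hQ
    refine hQd.continuousAt.eventually ?_
    rw [← he]
    exact ContinuousLinearEquiv.nhds e
  have hev : ∀ᶠ y in nhds x, (flatPullback G (inChart J Φ x) (extChartAt J x y)).IsInvertible :=
    (continuousAt_extChartAt (I := J) x).eventually hopen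
  filter_upwards [hev, extChartAt_source_mem_nhds (I := J) x] with y hy hys
  have hd := (hΦ y).mdifferentiableAt two_ne_zero
  have h1 := mvfderiv_eq_fderiv_inChart x hys hd (Y y)
  have h2 : (G (inChart J Φ x (extChartAt J x y)) (mvfderiv J Φ y (Y y))).comp
      (fderiv ℝ (inChart J Φ x) (extChartAt J x y))
      = flatPullback G (inChart J Φ x) (extChartAt J x y)
        (principalPart J (fun y : N => y) Y x y) := by
    rw [h1]; rfl
  exact ((congrArg _ h2).trans (hy.inverse_apply_self _)).symm

end PullbackConnection

/-! ### Smooth sections of the tangent bundle and their principal parts. -/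

section Smoothness

variable {E H F K W : Type*}
  [NormedAddCommGroup E] [NormedSpace ℝ E] [TopologicalSpace H]
  [NormedAddCommGroup F] [NormedSpace ℝ F] [TopologicalSpace K]
  [NormedAddCommGroup W] [NormedSpace ℝ W]
  {I : ModelWithCorners ℝ E H} {J : ModelWithCorners ℝ F K}
  {M : Type*} [TopologicalSpace M] [ChartedSpace H M]
  {N : Type*} [TopologicalSpace N] [ChartedSpace K N]
  [J.Boundaryless] [IsManifold J 1 N]
  {χ : M → N} {x : M} {V : (y : M) → TangentSpace J (χ y)}

/-- The trivialization of the tangent bundle at `χ x` is the differential of the preferred chart, so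
smoothness into the bundle is smoothness of the principal part. -/
lemma SmoothAlongAt.eventuallyEq_principalPart (hχ : ContinuousAt χ x) :
    (fun y => (trivializationAt F (TangentSpace J) (χ x)
        (⟨χ y, V y⟩ : TangentBundle J N)).2) =ᶠ[nhds x] principalPart J χ V x := by
  have : ∀ᶠ y in nhds x, χ y ∈ (chartAt K (χ x)).source :=
    hχ.eventually ((chartAt K (χ x)).open_source.mem_nhds (mem_chart_source K (χ x)))
  filter_upwards [this] with y hy
  have h := TangentBundle.continuousLinearMapAt_trivializationAt (I := J) hy
  have h2 := congrArg (fun l : TangentSpace J (χ y) →L[ℝ] F => l (V y)) h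
  refine Eq.trans ?_ h2
  have hb : χ y ∈ (trivializationAt F (TangentSpace J) (χ x)).baseSet := by simpa using hy
  exact (congrFun (Bundle.Trivialization.coe_linearMapAt_of_mem (R := ℝ) _ hb)
    (V y)).symm

lemma SmoothAlongAt.contMDiffAt (hV : SmoothAlongAt I χ V x) : ContMDiffAt I J ∞ χ x :=
  ((Bundle.contMDiffAt_totalSpace).1 hV).1

lemma SmoothAlongAt.contMDiffAt_principalPart (hV : SmoothAlongAt I χ V x) :
    ContMDiffAt I 𝓘(ℝ, F) ∞ (principalPart J χ V x) x :=
  ((Bundle.contMDiffAt_totalSpace).1 hV).2.congr_of_eventuallyEq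
    (eventuallyEq_principalPart hV.contMDiffAt.continuousAt).symm

lemma SmoothAlongAt.mdifferentiableAt_principalPart (hV : SmoothAlongAt I χ V x) :
    MDifferentiableAt I 𝓘(ℝ, F) (principalPart J χ V x) x :=
  hV.contMDiffAt_principalPart.mdifferentiableAt (by simp)

/-- A vector field which is smooth at `x` is differentiable near `x`. -/
lemma SmoothAlongAt.eventually_mdifferentiableAt [IsManifold I 1 M]
    [IsManifold J 2 N] (hV : SmoothAlongAt I χ V x) :
    ∀ᶠ y in nhds x, MDifferentiableAt I 𝓘(ℝ, F) (principalPart J χ V y) y := by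
  -- The chart used by `principalPart` moves with `y`, so the property is spread to nearby points in
  -- its chart-free form. The order is lowered to `1` because regularity at a point passes to a
  -- neighbourhood only for orders other than `∞`.
  have h1 : ∀ᶠ y in nhds x, ContMDiffAt I J.tangent 1
      (fun y => (⟨χ y, V y⟩ : TangentBundle J N)) y :=
    (contMDiffAt_iff_contMDiffAt_nhds (by simp)).1 (ContMDiffAt.of_le hV (by simp))
  filter_upwards [h1] with y hy
  have h2 := (Bundle.contMDiffAt_totalSpace).1 hy
  exact (h2.2.congr_of_eventuallyEq
    (eventuallyEq_principalPart h2.1.continuousAt).symm).mdifferentiableAt one_ne_zero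

lemma contMDiffAt_mvfderiv_apply {m : ℕ∞} [IsManifold J ∞ N] (hχ : ContMDiffAt I J m χ x)
    (hV : ContMDiffAt I 𝓘(ℝ, F) m (principalPart J χ V x) x) {Φ : N → W}
    (hΦ : ContMDiffAt J 𝓘(ℝ, W) (m + 1) Φ (χ x)) :
    ContMDiffAt I 𝓘(ℝ, W) m (fun y => mvfderiv J Φ (χ y) (V y)) x := by
  have hc : ContMDiffAt I 𝓘(ℝ, F) m (fun y => extChartAt J (χ x) (χ y)) x :=
    (contMDiffAt_extChartAt.of_le (by exact_mod_cast le_top)).comp x hχ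
  have hΨ : ContDiffAt ℝ (m + 1) (inChart J Φ (χ x)) (extChartAt J (χ x) (χ x)) :=
    contDiffAt_inChart hΦ
  have hf : ContDiffAt ℝ m (fun w : F × F => fderiv ℝ (inChart J Φ (χ x)) w.1 w.2)
      (extChartAt J (χ x) (χ x), principalPart J χ V x x) :=
    ContDiffAt.clm_apply (ContDiffAt.comp (g := fderiv ℝ (inChart J Φ (χ x))) 
      (extChartAt J (χ x) (χ x), principalPart J χ V x x)
      (hΨ.fderiv_right le_rfl) contDiffAt_fst) contDiffAt_snd
  have hcomp := hf.contMDiffAt.comp x (hc.prodMk_space hV)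
  refine hcomp.congr_of_eventuallyEq ?_
  have h1 : ∀ᶠ q in nhds (χ x), ContMDiffAt J 𝓘(ℝ, W) 1 Φ q :=
    (contMDiffAt_iff_contMDiffAt_nhds (by simp)).1 (hΦ.of_le le_add_self)
  filter_upwards [hχ.continuousAt.eventually h1,
    hχ.continuousAt.eventually (extChartAt_source_mem_nhds (I := J) (χ x))] with y hy hys
  exact mvfderiv_eq_fderiv_inChart (χ x) hys (hy.mdifferentiableAt one_ne_zero) _

lemma SmoothAlongAt.contMDiffAt_mvfderiv_apply [IsManifold J ∞ N] (hV : SmoothAlongAt I χ V x)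
    {Φ : N → W} (hΦ : ContMDiffAt J 𝓘(ℝ, W) ∞ Φ (χ x)) :
    ContMDiffAt I 𝓘(ℝ, W) ∞ (fun y => mvfderiv J Φ (χ y) (V y)) x :=
  WarpedHypersurface.contMDiffAt_mvfderiv_apply (m := ⊤) hV.contMDiffAt hV.contMDiffAt_principalPart hΦ

end Smoothness

/-! ### The embedding of the warped product in `ℝ × 𝔼ⁿ⁺¹`. -/

section FlatModel

variable {n k : ℕ} {c : ℤˣ} {I₀ : TopologicalSpace.Opens ℝ}

/-- In the chart at `p` the inclusion is the graph map, which is smooth where the radicand is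
positive. -/
lemma SpaceForm.contMDiff_incl :
    ContMDiff (𝓡 n) 𝓘(ℝ, EuclideanSpace ℝ (Fin (n + 1))) ∞
      (SpaceForm.incl : SpaceForm n k c → _) := by
  intro p
  refine contMDiffAt_iff.2 ⟨SpaceForm.continuous_incl.continuousAt, ?_⟩
  have hp : (0 : ℝ) < p.radicand (p.toModel p.incl) := p.chart.map_source (mem_chart_source _ p)
  have hopen : {y | 0 < p.radicand y} ∈ nhds (p.toModel p.incl) :=
    p.chart.open_target.mem_nhds hp
  have h1 : ContDiffAt ℝ ∞ p.graphMap (p.toModel p.incl) :=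
    (p.contDiffOn_graphMap.contDiffAt hopen).of_le (by simp)
  refine ContDiffAt.contDiffWithinAt (h1.congr_of_eventuallyEq ?_)
  filter_upwards [hopen] with y hy
  exact p.incl_chart_symm hy

/-- The embedding of the warped product in `ℝ × 𝔼ⁿ⁺¹`. -/
def toFlat (q : I₀ × SpaceForm n k c) : ℝ × EuclideanSpace ℝ (Fin (n + 1)) :=
  ((q.1 : ℝ), q.2.incl)

lemma mvfderiv_opens_val (t : I₀) (s : TangentSpace 𝓘(ℝ, ℝ) t) :
    mvfderiv 𝓘(ℝ, ℝ) (Subtype.val : I₀ → ℝ) t s = s := by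
  have hd : MDifferentiableAt 𝓘(ℝ, ℝ) 𝓘(ℝ, ℝ) (Subtype.val : I₀ → ℝ) t :=
    (contMDiff_subtype_val (n := 1)).mdifferentiableAt one_ne_zero
  rw [← fderiv_inChart_self hd]
  have : inChart 𝓘(ℝ, ℝ) (Subtype.val : I₀ → ℝ) t
      =ᶠ[nhds (extChartAt 𝓘(ℝ, ℝ) t t)] id := by
    filter_upwards [extChartAt_target_mem_nhds (I := 𝓘(ℝ, ℝ)) t] with z hz
    exact (extChartAt 𝓘(ℝ, ℝ) t).right_inv hz
  exact (congrArg (fun l : ℝ →L[ℝ] ℝ => l s) this.fderiv_eq).trans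
    (congrArg (fun l : ℝ →L[ℝ] ℝ => l s) fderiv_id)

lemma contMDiff_toFlat : ContMDiff (𝓘(ℝ, ℝ).prod (𝓡 n))
    𝓘(ℝ, ℝ × EuclideanSpace ℝ (Fin (n + 1))) ∞ (toFlat : I₀ × SpaceForm n k c → _) :=
  (contMDiff_subtype_val.comp contMDiff_fst).prodMk_space
    (SpaceForm.contMDiff_incl.comp contMDiff_snd)

lemma mvfderiv_toFlat (q : I₀ × SpaceForm n k c) (u : TangentSpace (𝓘(ℝ, ℝ).prod (𝓡 n)) q) :
    mvfderiv (𝓘(ℝ, ℝ).prod (𝓡 n)) toFlat q u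
      = (mvfderiv (𝓘(ℝ, ℝ).prod (𝓡 n)) (fun q : I₀ × SpaceForm n k c => (q.1 : ℝ)) q u,
        mvfderiv (𝓡 n) SpaceForm.incl q.2
          (mfderiv (𝓘(ℝ, ℝ).prod (𝓡 n)) (𝓡 n) (fun q : I₀ × SpaceForm n k c => q.2) q u)) := by
  have h1 : MDifferentiableAt (𝓘(ℝ, ℝ).prod (𝓡 n)) 𝓘(ℝ, ℝ)
      (fun q : I₀ × SpaceForm n k c => (q.1 : ℝ)) q :=
    ((contMDiff_subtype_val (n := 1)).comp contMDiff_fst).mdifferentiableAt one_ne_zero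
  have h2 : MDifferentiableAt (𝓘(ℝ, ℝ).prod (𝓡 n)) (𝓡 n)
      (fun q : I₀ × SpaceForm n k c => q.2) q :=
    (contMDiff_snd (n := 1)).mdifferentiableAt one_ne_zero
  have h3 := (SpaceForm.contMDiff_incl q.2).mdifferentiableAt (by simp)
  refine ((mvfderiv_prodMk h1 (h3.comp q h2)).2 u).trans ?_
  exact Prod.ext rfl (mfderiv_comp_apply q h3 h2 u)

lemma mvfderiv_toFlat_fst (q : I₀ × SpaceForm n k c)
    (u : TangentSpace (𝓘(ℝ, ℝ).prod (𝓡 n)) q) :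
    (mvfderiv (𝓘(ℝ, ℝ).prod (𝓡 n)) toFlat q u).1 = (u : ℝ × EuclideanSpace ℝ (Fin n)).1 := by
  rw [mvfderiv_toFlat]
  have h1 : MDifferentiableAt 𝓘(ℝ, ℝ) 𝓘(ℝ, ℝ) (Subtype.val : I₀ → ℝ) q.1 :=
    (contMDiff_subtype_val (n := 1)).mdifferentiableAt one_ne_zero
  have h2 : MDifferentiableAt (𝓘(ℝ, ℝ).prod (𝓡 n)) 𝓘(ℝ, ℝ)
      (fun q : I₀ × SpaceForm n k c => q.1) q :=
    (contMDiff_fst (n := 1)).mdifferentiableAt one_ne_zero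
  refine (mfderiv_comp_apply q h1 h2 u).trans ((mvfderiv_opens_val q.1 _).trans ?_)
  exact congrArg (fun l : ℝ × EuclideanSpace ℝ (Fin n) →L[ℝ] ℝ => l u) mfderiv_fst

lemma mvfderiv_toFlat_dt (q : I₀ × SpaceForm n k c) :
    mvfderiv (𝓘(ℝ, ℝ).prod (𝓡 n)) toFlat q (dt (𝓡 n) q) = (1, 0) := by
  refine Prod.ext (mvfderiv_toFlat_fst q _) ?_
  rw [mvfderiv_toFlat]
  have h : (mfderiv (𝓘(ℝ, ℝ).prod (𝓡 n)) (𝓡 n) (fun q : I₀ × SpaceForm n k c => q.2) q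
      (dt (𝓡 n) q) : EuclideanSpace ℝ (Fin n)) = 0 :=
    congrArg (fun l : ℝ × EuclideanSpace ℝ (Fin n) →L[ℝ] EuclideanSpace ℝ (Fin n) =>
      l (1, 0)) mfderiv_snd
  exact (congrArg (mvfderiv (𝓡 n) SpaceForm.incl q.2) h).trans (map_zero _)

/-- Differentiate the equation of the quadric. -/
lemma form_mvfderiv_toFlat (q : I₀ × SpaceForm n k c)
    (u : TangentSpace (𝓘(ℝ, ℝ).prod (𝓡 n)) q) :
    ambientForm n k c q.2.incl (mvfderiv (𝓘(ℝ, ℝ).prod (𝓡 n)) toFlat q u).2 = 0 := by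
  rw [mvfderiv_toFlat]
  generalize mfderiv (𝓘(ℝ, ℝ).prod (𝓡 n)) (𝓡 n) (fun q : I₀ × SpaceForm n k c => q.2) q u = w
  have h3 := (SpaceForm.contMDiff_incl q.2).mdifferentiableAt (by simp)
  have h4 : HasFDerivAt (fun y => ambientForm n k c y y) _ q.2.incl :=
    HasFDerivAt.clm_apply (ambientForm n k c).hasFDerivAt (hasFDerivAt_id q.2.incl)
  have h5 := (mvfderiv_comp_of_hasFDerivAt h3 h4).2 w
  have h6 : (fun y : SpaceForm n k c => ambientForm n k c y.incl y.incl) = fun _ => signR c :=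
    funext fun y => y.form_self
  rw [h6, mvfderiv_const] at h5
  have h7 := flatForm_comm (n + 1) (if c = 1 then k else k + 1) q.2.incl
    (mvfderiv (𝓡 n) SpaceForm.incl q.2 w)
  simp at h5
  linarith

/-- The metric `ε dt² + a(t)² b` on `ℝ × E`. -/
noncomputable def flatWarped {E : Type*} [NormedAddCommGroup E] [NormedSpace ℝ E]
    (b : E →L[ℝ] E →L[ℝ] ℝ) (ε : ℝ) (a : ℝ → ℝ) (w : ℝ × E) : ℝ × E →L[ℝ] ℝ × E →L[ℝ] ℝ :=
  ε • (ContinuousLinearMap.mul ℝ ℝ).bilinearComp (ContinuousLinearMap.fst ℝ ℝ E)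
      (ContinuousLinearMap.fst ℝ ℝ E)
    + (a w.1) ^ 2 • b.bilinearComp (ContinuousLinearMap.snd ℝ ℝ E) (ContinuousLinearMap.snd ℝ ℝ E)

lemma flatWarped_apply {E : Type*} [NormedAddCommGroup E] [NormedSpace ℝ E]
    (b : E →L[ℝ] E →L[ℝ] ℝ) (ε : ℝ) (a : ℝ → ℝ) (w u v : ℝ × E) :
    flatWarped b ε a w u v = ε * (u.1 * v.1) + (a w.1) ^ 2 * b u.2 v.2 := rfl

lemma warpedMetric_eq (ε : ℝ) (a : ℝ → ℝ) (q : I₀ × SpaceForm n k c)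
    (u w : TangentSpace (𝓘(ℝ, ℝ).prod (𝓡 n)) q) :
    warpedMetric ε I₀ a (SpaceForm.metric n k c) q u w
      = flatWarped (ambientForm n k c) ε a (toFlat q)
        (mvfderiv (𝓘(ℝ, ℝ).prod (𝓡 n)) toFlat q u) (mvfderiv (𝓘(ℝ, ℝ).prod (𝓡 n)) toFlat q w) := by
  rw [flatWarped_apply, mvfderiv_toFlat, mvfderiv_toFlat]
  rfl

end FlatModel

/-! ### Algebra of the connection and curvature of `ε dt² + a² b` on the cylinder. -/

section FlatWarped

variable {E : Type*} [NormedAddCommGroup E] [NormedSpace ℝ E]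
  {b : E →L[ℝ] E →L[ℝ] ℝ} {c ε : ℝ} {a : ℝ → ℝ}

/-- The derivative of `flatWarped`. -/
noncomputable def flatWarpedDeriv (b : E →L[ℝ] E →L[ℝ] ℝ) (a : ℝ → ℝ) (w : ℝ × E) :
    ℝ × E →L[ℝ] ℝ × E →L[ℝ] ℝ × E →L[ℝ] ℝ :=
  (ContinuousLinearMap.fst ℝ ℝ E).smulRight ((2 * a w.1 * deriv a w.1) •
    b.bilinearComp (ContinuousLinearMap.snd ℝ ℝ E) (ContinuousLinearMap.snd ℝ ℝ E))

lemma flatWarpedDeriv_apply (w z u v : ℝ × E) :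
    flatWarpedDeriv b a w z u v = z.1 * (2 * a w.1 * deriv a w.1 * b u.2 v.2) := rfl

lemma hasFDerivAt_const_add_smul {V V' : Type*} [NormedAddCommGroup V] [NormedSpace ℝ V]
    [NormedAddCommGroup V'] [NormedSpace ℝ V'] {s : V → ℝ} {s' : V →L[ℝ] ℝ} {w : V}
    (hs : HasFDerivAt s s' w) (x y : V') :
    HasFDerivAt (fun w => x + s w • y) (s'.smulRight y) w :=
  (hs.smul_const y).const_add x

lemma hasFDerivAt_flatWarped {w : ℝ × E} (ha : DifferentiableAt ℝ a w.1) :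
    HasFDerivAt (flatWarped b ε a) (flatWarpedDeriv b a w) w := by
  have h1 : HasFDerivAt (fun w : ℝ × E => a w.1)
      (deriv a w.1 • ContinuousLinearMap.fst ℝ ℝ E) w :=
    ha.hasDerivAt.comp_hasFDerivAt w hasFDerivAt_fst
  have h2 : HasFDerivAt (flatWarped b ε a) _ w := hasFDerivAt_const_add_smul (h1.pow 2)
    (ε • (ContinuousLinearMap.mul ℝ ℝ).bilinearComp
      (ContinuousLinearMap.fst ℝ ℝ E) (ContinuousLinearMap.fst ℝ ℝ E))
    (b.bilinearComp (ContinuousLinearMap.snd ℝ ℝ E) (ContinuousLinearMap.snd ℝ ℝ E))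
  refine h2.congr_fderiv ?_
  refine ContinuousLinearMap.ext fun z => ContinuousLinearMap.ext fun u =>
    ContinuousLinearMap.ext fun v => ?_
  rw [flatWarpedDeriv_apply]
  simp
  ring

/-- The difference between the Levi-Civita connection of the metric induced by
`ε dt² + a(t)² b` on `ℝ × {b = c}` and the flat connection of `ℝ × E`. -/
noncomputable def warpedGamma (b : E →L[ℝ] E →L[ℝ] ℝ) (c ε : ℝ) (a : ℝ → ℝ) (w u v : ℝ × E) :
    ℝ × E :=
  (-(ε * (a w.1 * deriv a w.1) * b u.2 v.2),
    (c * b u.2 v.2) • w.2 + (deriv a w.1 / a w.1) • (u.1 • v.2 + v.1 • u.2))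

/-- The derivative of `warpedGamma` in the base point. -/
noncomputable def warpedGammaDeriv (b : E →L[ℝ] E →L[ℝ] ℝ) (c ε : ℝ) (a : ℝ → ℝ)
    (w w' u v : ℝ × E) : ℝ × E :=
  (-(ε * (w'.1 * ((deriv a w.1) ^ 2 + a w.1 * deriv (deriv a) w.1)) * b u.2 v.2),
    (c * b u.2 v.2) • w'.2
      + (w'.1 * ((deriv (deriv a) w.1 * a w.1 - (deriv a w.1) ^ 2) / (a w.1) ^ 2))
        • (u.1 • v.2 + v.1 • u.2))

lemma warpedGamma_comm (hb : ∀ u v, b u v = b v u) (w u v : ℝ × E) :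
    warpedGamma b c ε a w u v = warpedGamma b c ε a w v u := by
  simp only [warpedGamma, hb u.2 v.2, add_comm]

lemma warpedGamma_add_left (w u u' v : ℝ × E) :
    warpedGamma b c ε a w (u + u') v = warpedGamma b c ε a w u v + warpedGamma b c ε a w u' v := by
  refine Prod.ext ?_ ?_
  · simp [warpedGamma]; ring
  · simp [warpedGamma]; module

lemma warpedGamma_smul_left (s : ℝ) (w u v : ℝ × E) :
    warpedGamma b c ε a w (s • u) v = s • warpedGamma b c ε a w u v := by
  refine Prod.ext ?_ ?_
  · simp [warpedGamma]; ring
  · simp [warpedGamma]; module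

lemma warpedGamma_add_right (w u v v' : ℝ × E) :
    warpedGamma b c ε a w u (v + v') = warpedGamma b c ε a w u v + warpedGamma b c ε a w u v' := by
  refine Prod.ext ?_ ?_
  · simp [warpedGamma]; ring
  · simp [warpedGamma]; module

lemma warpedGamma_smul_right (s : ℝ) (w u v : ℝ × E) :
    warpedGamma b c ε a w u (s • v) = s • warpedGamma b c ε a w u v := by
  refine Prod.ext ?_ ?_
  · simp [warpedGamma]; ring
  · simp [warpedGamma]; module

lemma flatWarped_comm (hb : ∀ u v, b u v = b v u) (w u v : ℝ × E) :
    flatWarped b ε a w u v = flatWarped b ε a w v u := by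
  rw [flatWarped_apply, flatWarped_apply, hb, mul_comm u.1]

lemma flatWarped_dt (w u : ℝ × E) :
    flatWarped b ε a w (1, 0) u = ε * u.1 := by
  simp [flatWarped_apply]

/-- The term `c b(u, v) p` of `warpedGamma` drops out because `z` is tangent to the cylinder. The
sign `ε` in the first component cancels the one in `ε dt²`. -/
lemma flatWarped_warpedGamma (hε : ε * ε = 1) {w : ℝ × E}
    (ha : a w.1 ≠ 0) (u v : ℝ × E) {z : ℝ × E} (hz : b w.2 z.2 = 0) :
    flatWarped b ε a w (warpedGamma b c ε a w u v) z
      = (1 / 2) * (flatWarpedDeriv b a w u v z + flatWarpedDeriv b a w v u z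
        - flatWarpedDeriv b a w z u v) := by
  simp only [flatWarped_apply, flatWarpedDeriv_apply, warpedGamma, map_add, map_smul, add_apply,
    smul_apply, smul_eq_mul, hz]
  field_simp
  linear_combination (-(deriv a w.1 * b u.2 v.2 * z.1)) * hε

lemma hasFDerivAt_warpedGamma {w u v : ℝ × E} (ha : ContDiffAt ℝ 2 a w.1) (ha0 : a w.1 ≠ 0) :
    ∃ L : (ℝ × E) × (ℝ × E) × (ℝ × E) →L[ℝ] ℝ × E,
      HasFDerivAt (fun z : (ℝ × E) × (ℝ × E) × (ℝ × E) =>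
        warpedGamma b c ε a z.1 z.2.1 z.2.2) L (w, u, v) ∧
      ∀ w' u' v', L (w', u', v') =
        warpedGammaDeriv b c ε a w w' u v + (warpedGamma b c ε a w u' v + warpedGamma b c ε a w u v') := by
  have hz : HasFDerivAt (fun z : (ℝ × E) × (ℝ × E) × (ℝ × E) => z) _ (w, u, v) :=
    hasFDerivAt_id (𝕜 := ℝ) _
  have ht := hz.fst.fst
  have hp := hz.fst.snd
  have hu := hz.snd.fst
  have hv := hz.snd.snd
  have hu1 := hu.fst
  have hu2 := hu.snd
  have hv1 := hv.fst
  have hv2 := hv.snd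
  have hda : HasDerivAt a (deriv a w.1) w.1 := (ha.differentiableAt two_ne_zero).hasDerivAt
  have hdda : HasDerivAt (deriv a) (deriv (deriv a) w.1) w.1 := by
    refine DifferentiableAt.hasDerivAt ?_
    have h : deriv a = fun t => fderiv ℝ a t 1 := funext fun t => fderiv_apply_one_eq_deriv.symm
    rw [h]
    exact ((ha.fderiv_right (m := 1) le_rfl).differentiableAt one_ne_zero).clm_apply
      (differentiableAt_const 1)
  have h1 := (hda.mul hdda).comp_hasFDerivAt (w, u, v) ht
  have h2 := (hdda.div hda ha0).comp_hasFDerivAt (w, u, v) ht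
  have hb := (HasFDerivAt.comp (g := b) (w, u, v) b.hasFDerivAt hu2).clm_apply hv2
  have h := (((h1.const_mul ε).mul hb).neg).prodMk (((hb.const_mul c).smul hp).add
    (h2.smul ((hu1.smul hv2).add (hv1.smul hu2))))
  refine ⟨_, h, fun w' u' v' => ?_⟩
  refine Prod.ext ?_ ?_
  · simp [warpedGamma, warpedGammaDeriv]; ring
  · simp [warpedGamma, warpedGammaDeriv]; module

/-- The curvature operator of the metric induced by `ε dt² + a(t)² b` on `ℝ × {b = c}`. -/
noncomputable def warpedCurvature (b : E →L[ℝ] E →L[ℝ] ℝ) (c ε : ℝ) (a : ℝ → ℝ)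
    (w x y v : ℝ × E) : ℝ × E :=
  warpedGammaDeriv b c ε a w x y v - warpedGammaDeriv b c ε a w y x v
    + warpedGamma b c ε a w x (warpedGamma b c ε a w y v)
    - warpedGamma b c ε a w y (warpedGamma b c ε a w x v)

/-- Only `x` and `y` need be tangent to the cylinder: the products of `u` with the position vector
cancel on antisymmetrizing in `x` and `y`. Here `ε * y.1` stands for the product of `y` with `∂_t`.
-/
lemma flatWarped_warpedCurvature (hb : ∀ u v, b u v = b v u) (hε : ε * ε = 1)
    {w : ℝ × E} (ha : a w.1 ≠ 0) {x y v u : ℝ × E} (hx : b w.2 x.2 = 0)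
    (hy : b w.2 y.2 = 0) :
    flatWarped b ε a w (warpedCurvature b c ε a w x y v) u
      = (ε * (deriv a w.1) ^ 2 / (a w.1) ^ 2 - c / (a w.1) ^ 2)
          * (flatWarped b ε a w x v * flatWarped b ε a w y u
            - flatWarped b ε a w y v * flatWarped b ε a w x u)
        + (deriv (deriv a) w.1 / a w.1 - (deriv a w.1) ^ 2 / (a w.1) ^ 2 + ε * c / (a w.1) ^ 2)
          * (flatWarped b ε a w x v * (ε * y.1) * (ε * u.1)
            - flatWarped b ε a w y v * (ε * x.1) * (ε * u.1)
            - flatWarped b ε a w x u * (ε * y.1) * (ε * v.1)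
            + flatWarped b ε a w y u * (ε * x.1) * (ε * v.1)) := by
  have hxw : b x.2 w.2 = 0 := (hb _ _).trans hx
  have hyw : b y.2 w.2 = 0 := (hb _ _).trans hy
  simp only [flatWarped_apply, warpedCurvature, warpedGamma, warpedGammaDeriv, map_add, map_smul,
    map_sub, add_apply, sub_apply, smul_apply, smul_eq_mul, hxw, hyw, hb y.2 x.2]
  -- With all products and derivatives replaced by independent scalars, the claim is a rational
  -- identity, checked for each sign of `ε`.
  generalize b x.2 y.2 = xy
  generalize b x.2 v.2 = xv
  generalize b y.2 v.2 = yv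
  generalize b x.2 u.2 = xu
  generalize b y.2 u.2 = yu
  generalize b v.2 u.2 = vu
  generalize b w.2 u.2 = wu
  generalize deriv (deriv a) w.1 = a2
  generalize deriv a w.1 = a1
  generalize a w.1 = a0 at ha ⊢
  generalize x.1 = x1
  generalize y.1 = y1
  generalize u.1 = u1
  generalize v.1 = v1
  field_simp
  rcases mul_self_eq_one_iff.1 hε with rfl | rfl
  · ring
  · ring

end FlatWarped

/-! ### The covariant derivative along a map into the cylinder. -/

section FlatCov

variable {E F H : Type*} [NormedAddCommGroup E] [NormedSpace ℝ E]
  [NormedAddCommGroup F] [NormedSpace ℝ F] [TopologicalSpace H]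
  {I : ModelWithCorners ℝ F H} {M : Type*} [TopologicalSpace M] [ChartedSpace H M]
  {b : E →L[ℝ] E →L[ℝ] ℝ} {c ε : ℝ} {a : ℝ → ℝ} {Φ : M → ℝ × E} {x : M}

/-- The covariant derivative of a vector field along `Φ`, for the metric induced by
`ε dt² + a(t)² b` on `ℝ × {b = c}`. -/
noncomputable def flatCov (I : ModelWithCorners ℝ F H) (b : E →L[ℝ] E →L[ℝ] ℝ) (c ε : ℝ)
    (a : ℝ → ℝ) (Φ V : M → ℝ × E) (x : M) (v : TangentSpace I x) : ℝ × E :=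
  mvfderiv I V x v + warpedGamma b c ε a (Φ x) (mvfderiv I Φ x v) (V x)

lemma mvfderiv_snd {V : M → ℝ × E} (hV : MDifferentiableAt I 𝓘(ℝ, ℝ × E) V x)
    (v : TangentSpace I x) :
    MDifferentiableAt I 𝓘(ℝ, E) (fun y => (V y).2) x ∧
      mvfderiv I (fun y => (V y).2) x v = (mvfderiv I V x v).2 :=
  have h := mvfderiv_comp_of_hasFDerivAt hV (hasFDerivAt_snd (𝕜 := ℝ) (p := V x))
  ⟨h.1, h.2 v⟩

lemma mvfderiv_form {V U : M → E} (hV : MDifferentiableAt I 𝓘(ℝ, E) V x)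
    (hU : MDifferentiableAt I 𝓘(ℝ, E) U x) (v : TangentSpace I x) :
    mvfderiv I (fun y => b (V y) (U y)) x v
      = b (mvfderiv I V x v) (U x) + b (V x) (mvfderiv I U x v) := by
  have h0 := mvfderiv_prodMk hV hU
  have h1 : HasFDerivAt (fun z : E × E => b z.1 z.2) _ (V x, U x) :=
    (HasFDerivAt.comp (g := b) (V x, U x) b.hasFDerivAt hasFDerivAt_fst).clm_apply hasFDerivAt_snd
  have h2 := (mvfderiv_comp_of_hasFDerivAt h0.1 h1).2 v
  rw [h2, h0.2]
  simp [add_comm]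

lemma form_mvfderiv_of_form_eq_const (hb : ∀ u v, b u v = b v u)
    (hΦ : MDifferentiableAt I 𝓘(ℝ, ℝ × E) Φ x) (hc : ∀ y, b (Φ y).2 (Φ y).2 = c)
    (v : TangentSpace I x) : b (Φ x).2 (mvfderiv I Φ x v).2 = 0 := by
  have h := mvfderiv_snd hΦ v
  have h1 := mvfderiv_form (b := b) h.1 h.1 v
  rw [show (fun y => b (Φ y).2 (Φ y).2) = fun _ => c from funext hc, mvfderiv_const, h.2,
    hb _ (Φ x).2] at h1
  simp at h1
  linarith

lemma flatWarped_flatCov (hε : ε * ε = 1) (ha0 : a (Φ x).1 ≠ 0) (V : M → ℝ × E)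
    (v : TangentSpace I x) {z : ℝ × E} (hz : b (Φ x).2 z.2 = 0) :
    flatWarped b ε a (Φ x) (flatCov I b c ε a Φ V x v) z
      = flatWarped b ε a (Φ x) (mvfderiv I V x v) z
        + (1 / 2) * (flatWarpedDeriv b a (Φ x) (mvfderiv I Φ x v) (V x) z
          + flatWarpedDeriv b a (Φ x) (V x) (mvfderiv I Φ x v) z
          - flatWarpedDeriv b a (Φ x) z (mvfderiv I Φ x v) (V x)) := by
  rw [flatCov, map_add, add_apply, flatWarped_warpedGamma hε ha0 _ _ hz]

/-- Compatibility with the metric: on adding the two Koszul expressions, the terms where `G` is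
differentiated along `V` or `U` cancel, and the derivative of `G` along `v` remains. Tangency of `V`
and `U` at the single point `x` is enough. -/
lemma mvfderiv_flatWarped (hb : ∀ u v, b u v = b v u) (hε : ε * ε = 1)
    (ha : DifferentiableAt ℝ a (Φ x).1) (ha0 : a (Φ x).1 ≠ 0)
    (hΦ : MDifferentiableAt I 𝓘(ℝ, ℝ × E) Φ x) {V U : M → ℝ × E}
    (hV : MDifferentiableAt I 𝓘(ℝ, ℝ × E) V x) (hU : MDifferentiableAt I 𝓘(ℝ, ℝ × E) U x)
    (hVt : b (Φ x).2 (V x).2 = 0) (hUt : b (Φ x).2 (U x).2 = 0) (v : TangentSpace I x) :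
    MDifferentiableAt I 𝓘(ℝ, ℝ) (fun y => flatWarped b ε a (Φ y) (V y) (U y)) x ∧
    mvfderiv I (fun y => flatWarped b ε a (Φ y) (V y) (U y)) x v
      = flatWarped b ε a (Φ x) (flatCov I b c ε a Φ V x v) (U x)
        + flatWarped b ε a (Φ x) (V x) (flatCov I b c ε a Φ U x v) := by
  have h0 := mvfderiv_prodMk hV hU
  have h1 := mvfderiv_prodMk hΦ h0.1
  have hz : HasFDerivAt (fun z : (ℝ × E) × (ℝ × E) × (ℝ × E) => z) _ (Φ x, V x, U x) :=
    hasFDerivAt_id (𝕜 := ℝ) _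
  have h2 : HasFDerivAt (fun z : (ℝ × E) × (ℝ × E) × (ℝ × E) =>
      flatWarped b ε a z.1 z.2.1 z.2.2) _ (Φ x, V x, U x) :=
    ((HasFDerivAt.comp (g := flatWarped b ε a) (Φ x, V x, U x) (hasFDerivAt_flatWarped ha)
      hz.fst).clm_apply hz.snd.fst).clm_apply hz.snd.snd
  have h3 := mvfderiv_comp_of_hasFDerivAt h1.1 h2
  refine ⟨h3.1, (h3.2 v).trans ?_⟩
  rw [h1.2, h0.2]
  have e1 := flatWarped_flatCov (c := c) hε ha0 V v hUt
  have e2 := flatWarped_flatCov (c := c) hε ha0 U v hVt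
  rw [flatWarped_comm hb] at e2
  rw [e1, e2]
  have h5 := hb (V x).2 (U x).2
  -- The derivative of the trilinear expression unfolds to the three terms of the product rule.
  refine Eq.trans (b := flatWarped b ε a (Φ x) (V x) (mvfderiv I U x v)
    + (flatWarped b ε a (Φ x) (mvfderiv I V x v) (U x)
      + flatWarpedDeriv b a (Φ x) (mvfderiv I Φ x v) (V x) (U x))) rfl ?_
  rw [flatWarped_comm hb (Φ x) (V x)]
  simp only [flatWarpedDeriv_apply, h5]
  ring

/-- Differentiating `b(p, V) = 0` gives `b(p, dV(v)) = -b(dΦ v, V)`, which the term `c b(dΦ v, V) p`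
compensates since `b(p, p) = c` and `c² = 1`. -/
lemma form_flatCov (hb : ∀ u v, b u v = b v u) (hc : c * c = 1)
    (hΦ : MDifferentiableAt I 𝓘(ℝ, ℝ × E) Φ x) (hΦc : ∀ y, b (Φ y).2 (Φ y).2 = c)
    {V : M → ℝ × E} (hV : MDifferentiableAt I 𝓘(ℝ, ℝ × E) V x)
    (hVt : ∀ᶠ y in nhds x, b (Φ y).2 (V y).2 = 0) (v : TangentSpace I x) :
    b (Φ x).2 (flatCov I b c ε a Φ V x v).2 = 0 := by
  have h1 := mvfderiv_snd hΦ v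
  have h2 := mvfderiv_snd hV v
  have h3 := mvfderiv_form (b := b) h1.1 h2.1 v
  have h4 : mvfderiv I (fun y => b (Φ y).2 (V y).2) x v = 0 := by
    have h5 : (fun y => b (Φ y).2 (V y).2) =ᶠ[nhds x] fun _ => (0 : ℝ) := hVt
    have h6 : mvfderiv I (fun y => b (Φ y).2 (V y).2) x v = mvfderiv I (fun _ : M => (0 : ℝ)) x v :=
      congrArg (fun l : TangentSpace I x →L[ℝ] ℝ => l v) h5.mfderiv_eq
    rw [h6, mvfderiv_const]; rfl
  rw [h4, h1.2, h2.2] at h3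
  have h5 := form_mvfderiv_of_form_eq_const hb hΦ hΦc v
  simp only [flatCov, warpedGamma, Prod.snd_add, map_add, map_smul, smul_eq_mul, hΦc x, h5,
    hVt.self_of_nhds]
  linear_combination -h3 + b (mvfderiv I Φ x v).2 (V x).2 * hc

lemma mvfderiv_warpedGamma (ha : ContDiffAt ℝ 2 a (Φ x).1) (ha0 : a (Φ x).1 ≠ 0)
    (hΦ : MDifferentiableAt I 𝓘(ℝ, ℝ × E) Φ x) {U V : M → ℝ × E}
    (hU : MDifferentiableAt I 𝓘(ℝ, ℝ × E) U x) (hV : MDifferentiableAt I 𝓘(ℝ, ℝ × E) V x)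
    (v : TangentSpace I x) :
    MDifferentiableAt I 𝓘(ℝ, ℝ × E) (fun y => warpedGamma b c ε a (Φ y) (U y) (V y)) x ∧
    mvfderiv I (fun y => warpedGamma b c ε a (Φ y) (U y) (V y)) x v
      = warpedGammaDeriv b c ε a (Φ x) (mvfderiv I Φ x v) (U x) (V x)
        + (warpedGamma b c ε a (Φ x) (mvfderiv I U x v) (V x)
          + warpedGamma b c ε a (Φ x) (U x) (mvfderiv I V x v)) := by
  have h0 := mvfderiv_prodMk hU hV
  have h1 := mvfderiv_prodMk hΦ h0.1
  obtain ⟨L, hL, hL'⟩ := hasFDerivAt_warpedGamma (b := b) (c := c) (ε := ε) (w := Φ x)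
    (u := U x) (v := V x) ha ha0
  have h3 := mvfderiv_comp_of_hasFDerivAt h1.1 hL
  refine ⟨h3.1, (h3.2 v).trans ?_⟩
  rw [h1.2, h0.2, hL']

lemma flatCov_add {V U : M → ℝ × E} (hV : MDifferentiableAt I 𝓘(ℝ, ℝ × E) V x)
    (hU : MDifferentiableAt I 𝓘(ℝ, ℝ × E) U x) (v : TangentSpace I x) :
    flatCov I b c ε a Φ (fun y => V y + U y) x v
      = flatCov I b c ε a Φ V x v + flatCov I b c ε a Φ U x v := by
  simp only [flatCov, warpedGamma_add_right, mvfderiv_fun_add hV hU, add_apply]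
  abel

lemma flatCov_smul {s : M → ℝ} {V : M → ℝ × E} (hs : MDifferentiableAt I 𝓘(ℝ, ℝ) s x)
    (hV : MDifferentiableAt I 𝓘(ℝ, ℝ × E) V x) (v : TangentSpace I x) :
    flatCov I b c ε a Φ (fun y => s y • V y) x v
      = s x • flatCov I b c ε a Φ V x v + mvfderiv I s x v • V x := by
  simp only [flatCov, warpedGamma_smul_right, mvfderiv_fun_smul hs hV, add_apply, smul_apply,
    ContinuousLinearMap.smulRight_apply, smul_add]
  abel

lemma flatCov_congr {V U : M → ℝ × E} (h : V =ᶠ[nhds x] U) (v : TangentSpace I x) :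
    flatCov I b c ε a Φ V x v = flatCov I b c ε a Φ U x v := by
  have : mvfderiv I V x v = mvfderiv I U x v :=
    congrArg (fun l : TangentSpace I x →L[ℝ] ℝ × E => l v) h.mfderiv_eq
  rw [flatCov, flatCov, this, h.self_of_nhds]

lemma flatCov_add_dir (V : M → ℝ × E) (v w : TangentSpace I x) :
    flatCov I b c ε a Φ V x (v + w) = flatCov I b c ε a Φ V x v + flatCov I b c ε a Φ V x w := by
  simp only [flatCov, map_add, warpedGamma_add_left]
  abel

lemma flatCov_neg (V : M → ℝ × E) (v : TangentSpace I x) :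
    flatCov I b c ε a Φ (fun y => -V y) x v = -flatCov I b c ε a Φ V x v := by
  have h := warpedGamma_smul_right (b := b) (c := c) (ε := ε) (a := a) (-1) (Φ x)
    (mvfderiv I Φ x v) (V x)
  simp only [neg_one_smul] at h
  simp only [flatCov, h, mvfderiv_fun_neg, neg_apply, neg_add]

variable [I.Boundaryless] [IsManifold I 1 M] [IsManifold I 2 M] [CompleteSpace F]
  {X Y : (y : M) → TangentSpace I y}

/-- Absence of torsion: `warpedGamma` is symmetric, so only the commutator of the two fields acting
on `Φ` remains. -/
lemma flatCov_mvfderiv_sub (hb : ∀ u v, b u v = b v u)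
    (hΦ : ContMDiffAt I 𝓘(ℝ, ℝ × E) 2 Φ x)
    (hX : MDifferentiableAt I 𝓘(ℝ, F) (principalPart I (fun y : M => y) X x) x)
    (hY : MDifferentiableAt I 𝓘(ℝ, F) (principalPart I (fun y : M => y) Y x) x) :
    flatCov I b c ε a Φ (fun y => mvfderiv I Φ y (Y y)) x (X x)
        - flatCov I b c ε a Φ (fun y => mvfderiv I Φ y (X y)) x (Y x)
      = mvfderiv I Φ x (VectorField.mlieBracket I X Y x) := by
  rw [← mvfderiv_mvfderiv_sub hΦ hX hY, flatCov, flatCov,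
    warpedGamma_comm hb _ (mvfderiv I Φ x (X x))]
  abel

lemma mdifferentiableAt_flatCov (ha : ContDiffAt ℝ 2 a (Φ x).1)
    (ha0 : a (Φ x).1 ≠ 0) (hΦ : ContMDiffAt I 𝓘(ℝ, ℝ × E) 2 Φ x) {V : M → ℝ × E}
    (hV : ContMDiffAt I 𝓘(ℝ, ℝ × E) 2 V x)
    (hY : MDifferentiableAt I 𝓘(ℝ, F) (principalPart I (fun y : M => y) Y x) x) :
    MDifferentiableAt I 𝓘(ℝ, ℝ × E) (fun y => flatCov I b c ε a Φ V y (Y y)) x := by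
  have hid : MDifferentiableAt I I (fun y : M => y) x := mdifferentiableAt_id
  have h1 := (hasMFDerivAt_mvfderiv_apply (χ := fun y : M => y) hV hid hY).1
  have h2 := (hasMFDerivAt_mvfderiv_apply (χ := fun y : M => y) hΦ hid hY).1
  exact h1.add (mvfderiv_warpedGamma ha ha0 (hΦ.mdifferentiableAt two_ne_zero) h2
    (hV.mdifferentiableAt two_ne_zero) 0).1

/-- The Ricci identity for `flatCov`. -/
lemma flatCov_flatCov_sub (ha : ContDiffAt ℝ 2 a (Φ x).1)
    (ha0 : a (Φ x).1 ≠ 0) (hΦ : ContMDiffAt I 𝓘(ℝ, ℝ × E) 2 Φ x) {V : M → ℝ × E}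
    (hV : ContMDiffAt I 𝓘(ℝ, ℝ × E) 2 V x)
    (hX : MDifferentiableAt I 𝓘(ℝ, F) (principalPart I (fun y : M => y) X x) x)
    (hY : MDifferentiableAt I 𝓘(ℝ, F) (principalPart I (fun y : M => y) Y x) x) :
    flatCov I b c ε a Φ (fun y => flatCov I b c ε a Φ V y (Y y)) x (X x)
        - flatCov I b c ε a Φ (fun y => flatCov I b c ε a Φ V y (X y)) x (Y x)
        - flatCov I b c ε a Φ V x (VectorField.mlieBracket I X Y x)
      = warpedCurvature b c ε a (Φ x) (mvfderiv I Φ x (X x)) (mvfderiv I Φ x (Y x)) (V x) := by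
  have hid : MDifferentiableAt I I (fun y : M => y) x := mdifferentiableAt_id
  have hVd := hV.mdifferentiableAt two_ne_zero
  have hΦd := hΦ.mdifferentiableAt two_ne_zero
  have key : ∀ X Y : (y : M) → TangentSpace I y,
      MDifferentiableAt I 𝓘(ℝ, F) (principalPart I (fun y : M => y) Y x) x →
      flatCov I b c ε a Φ (fun y => flatCov I b c ε a Φ V y (Y y)) x (X x)
        = mvfderiv I (fun y => mvfderiv I V y (Y y)) x (X x)
          + (warpedGammaDeriv b c ε a (Φ x) (mvfderiv I Φ x (X x)) (mvfderiv I Φ x (Y x)) (V x)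
            + (warpedGamma b c ε a (Φ x) (mvfderiv I (fun y => mvfderiv I Φ y (Y y)) x (X x)) (V x)
            + warpedGamma b c ε a (Φ x) (mvfderiv I Φ x (Y x)) (mvfderiv I V x (X x))))
          + (warpedGamma b c ε a (Φ x) (mvfderiv I Φ x (X x)) (mvfderiv I V x (Y x))
            + warpedGamma b c ε a (Φ x) (mvfderiv I Φ x (X x))
              (warpedGamma b c ε a (Φ x) (mvfderiv I Φ x (Y x)) (V x))) := by
    intro X Y hY
    have h1 := (hasMFDerivAt_mvfderiv_apply (χ := fun y : M => y) hV hid hY).1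
    have h2 := (hasMFDerivAt_mvfderiv_apply (χ := fun y : M => y) hΦ hid hY).1
    have h3 := mvfderiv_warpedGamma (b := b) (c := c) (ε := ε) ha ha0 hΦd h2 hVd (X x)
    rw [← h3.2, flatCov]
    simp only [flatCov, mvfderiv_fun_add h1 h3.1, add_apply, warpedGamma_add_right]
  have hneg : ∀ u v : ℝ × E, warpedGamma b c ε a (Φ x) (u - v) (V x)
      = warpedGamma b c ε a (Φ x) u (V x) - warpedGamma b c ε a (Φ x) v (V x) := fun u v => by
    rw [sub_eq_add_neg, warpedGamma_add_left, ← neg_one_smul ℝ v, warpedGamma_smul_left,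
      neg_one_smul, ← sub_eq_add_neg]
  -- The second derivatives of `V` and `Φ` give the bracket terms. The terms with one derivative of
  -- `V` are symmetric in `X` and `Y` and cancel, leaving the terms of order zero.
  rw [key X Y hY, key Y X hX, flatCov, ← mvfderiv_mvfderiv_sub hV hX hY,
    ← mvfderiv_mvfderiv_sub hΦ hX hY, hneg, warpedCurvature]
  abel

end FlatCov

/-! ### Comparison of `flatCov` with the Levi-Civita connection. -/

section Connection

variable {E F H F' H' : Type*} [NormedAddCommGroup E] [NormedSpace ℝ E]
  [NormedAddCommGroup F] [NormedSpace ℝ F] [TopologicalSpace H] [FiniteDimensional ℝ F]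
  [NormedAddCommGroup F'] [NormedSpace ℝ F'] [TopologicalSpace H']
  {J : ModelWithCorners ℝ F H} {N : Type*} [TopologicalSpace N] [ChartedSpace H N]
  {I : ModelWithCorners ℝ F' H'} {M : Type*} [TopologicalSpace M] [ChartedSpace H' M]
  [J.Boundaryless] [IsManifold J 1 N] [IsManifold J 2 N]
  {b : E →L[ℝ] E →L[ℝ] ℝ} {c ε : ℝ} {a : ℝ → ℝ} {Φ : N → ℝ × E} {g : MetricField J N}

/-- The Levi-Civita connection of a metric induced by `ε dt² + a(t)² b` on a submanifold of
`ℝ × {b = c}`. -/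
lemma metric_covDerivAlong_flatWarped (hb : ∀ u v, b u v = b v u) (hε : ε * ε = 1)
    (hΦ : ContMDiff J 𝓘(ℝ, ℝ × E) 2 Φ)
    (hg : ∀ q u w, g q u w = flatWarped b ε a (Φ q) (mvfderiv J Φ q u) (mvfderiv J Φ q w))
    {χ : M → N} {x : M} (ha : DifferentiableAt ℝ a (Φ (χ x)).1) (ha0 : a (Φ (χ x)).1 ≠ 0)
    (ht : ∀ w, b (Φ (χ x)).2 (mvfderiv J Φ (χ x) w).2 = 0)
    (hnd : ∀ u : TangentSpace J (χ x), (∀ w, g (χ x) u w = 0) → u = 0)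
    (hχ : MDifferentiableAt I J χ x) {V : (y : M) → TangentSpace J (χ y)}
    (hV : MDifferentiableAt I 𝓘(ℝ, F) (principalPart J χ V x) x)
    (v : TangentSpace I x) (w : TangentSpace J (χ x)) :
    g (χ x) (covDerivAlong g χ V x v) w
      = flatWarped b ε a (Φ (χ x)) (flatCov I b c ε a (fun y => Φ (χ y))
          (fun y => mvfderiv J Φ (χ y) (V y)) x v) (mvfderiv J Φ (χ x) w) := by
  have h := metric_covDerivAlong hΦ hg hχ hV (hasFDerivAt_flatWarped ha)
    (fun u w => flatWarped_comm hb _ u w) hnd v w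
  have h1 : mvfderiv I (fun y => Φ (χ y)) x v = mvfderiv J Φ (χ x) (mfderiv I J χ x v) :=
    mfderiv_comp_apply x ((hΦ _).mdifferentiableAt two_ne_zero) hχ v
  rw [h, flatCov, map_add, add_apply, flatWarped_warpedGamma hε ha0 _ _ (ht w), h1]

end Connection

/-! ### Gauss and Weingarten formulas in the flat picture. -/

section Hypersurface

variable {E F H : Type*} [NormedAddCommGroup E] [NormedSpace ℝ E]
  [NormedAddCommGroup F] [NormedSpace ℝ F] [TopologicalSpace H]

/-- A hypersurface `Φ`, with unit normal `ν` and induced metric `g`, of the hypersurface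
`{b (p, p) = c}` of `ℝ × E` with the metric `ε dt² + a(t)² b`. -/
structure IsFlatHypersurface (I : ModelWithCorners ℝ F H) {M : Type*} [TopologicalSpace M]
    [ChartedSpace H M] (b : E →L[ℝ] E →L[ℝ] ℝ) (c ε δ : ℝ) (a : ℝ → ℝ) (Φ ν : M → ℝ × E)
    (g : MetricField I M) : Prop where
  symm : ∀ u v, b u v = b v u
  c_mul_self : c * c = 1
  eps_mul_self : ε * ε = 1
  delta_mul_self : δ * δ = 1
  contDiffAt : ∀ x, ContDiffAt ℝ 2 a (Φ x).1
  ne_zero : ∀ x, a (Φ x).1 ≠ 0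
  smooth : ContMDiff I 𝓘(ℝ, ℝ × E) ∞ Φ
  smooth_normal : ContMDiff I 𝓘(ℝ, ℝ × E) ∞ ν
  quadric : ∀ x, b (Φ x).2 (Φ x).2 = c
  normal_mem : ∀ x, b (Φ x).2 (ν x).2 = 0
  metric : ∀ x u w, g x u w = flatWarped b ε a (Φ x) (mvfderiv I Φ x u) (mvfderiv I Φ x w)
  normal : ∀ x u, flatWarped b ε a (Φ x) (ν x) (mvfderiv I Φ x u) = 0
  unit : ∀ x, flatWarped b ε a (Φ x) (ν x) (ν x) = δ
  nondegenerate : Nondegenerate g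
  finrank_eq : Module.finrank ℝ E = Module.finrank ℝ F + 1

namespace IsFlatHypersurface

variable [FiniteDimensional ℝ F] [FiniteDimensional ℝ E]
  {I : ModelWithCorners ℝ F H} {M : Type*} [TopologicalSpace M] [ChartedSpace H M]
  {b : E →L[ℝ] E →L[ℝ] ℝ} {c ε δ : ℝ} {a : ℝ → ℝ} {Φ ν : M → ℝ × E} {g : MetricField I M}

lemma mdifferentiableAt (h : IsFlatHypersurface I b c ε δ a Φ ν g) (x : M) :
    MDifferentiableAt I 𝓘(ℝ, ℝ × E) Φ x :=
  (h.smooth x).mdifferentiableAt (by simp)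

lemma mdifferentiableAt_normal (h : IsFlatHypersurface I b c ε δ a Φ ν g) (x : M) :
    MDifferentiableAt I 𝓘(ℝ, ℝ × E) ν x :=
  (h.smooth_normal x).mdifferentiableAt (by simp)

lemma contMDiff_two (h : IsFlatHypersurface I b c ε δ a Φ ν g) :
    ContMDiff I 𝓘(ℝ, ℝ × E) 2 Φ :=
  h.smooth.of_le ENat.LEInfty.out

lemma contMDiff_two_normal (h : IsFlatHypersurface I b c ε δ a Φ ν g) :
    ContMDiff I 𝓘(ℝ, ℝ × E) 2 ν :=
  h.smooth_normal.of_le ENat.LEInfty.out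

lemma differentiableAt (h : IsFlatHypersurface I b c ε δ a Φ ν g) (x : M) :
    DifferentiableAt ℝ a (Φ x).1 :=
  (h.contDiffAt x).differentiableAt two_ne_zero

lemma form_mvfderiv (h : IsFlatHypersurface I b c ε δ a Φ ν g) (x : M) (u : TangentSpace I x) :
    b (Φ x).2 (mvfderiv I Φ x u).2 = 0 :=
  form_mvfderiv_of_form_eq_const h.symm (h.mdifferentiableAt x) h.quadric u

lemma comm (h : IsFlatHypersurface I b c ε δ a Φ ν g) (x : M) (u w : ℝ × E) :
    flatWarped b ε a (Φ x) u w = flatWarped b ε a (Φ x) w u :=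
  flatWarped_comm h.symm _ _ _

lemma metric_comm (h : IsFlatHypersurface I b c ε δ a Φ ν g) (x : M) (u w : TangentSpace I x) :
    g x u w = g x w u := by
  rw [h.metric, h.metric, h.comm]

lemma eq_of_metric (h : IsFlatHypersurface I b c ε δ a Φ ν g) {x : M} {u u' : TangentSpace I x}
    (hu : ∀ w, g x u w = g x u' w) : u = u' :=
  sub_eq_zero.1 (h.nondegenerate x _ fun w => by rw [map_sub, sub_apply, hu, sub_self])

lemma eq_zero_of_combination (h : IsFlatHypersurface I b c ε δ a Φ ν g) {x : M}
    {u : TangentSpace I x} {s r : ℝ}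
    (hz : mvfderiv I Φ x u + s • ν x + r • ((0 : ℝ), (Φ x).2) = 0) : u = 0 ∧ s = 0 ∧ r = 0 := by
  have hr : r = 0 := by
    have h1 : b (Φ x).2 (mvfderiv I Φ x u + s • ν x + r • ((0 : ℝ), (Φ x).2)).2 = 0 := by
      rw [hz]; simp
    simp only [Prod.snd_add, Prod.smul_snd, map_add, map_smul, h.form_mvfderiv, h.normal_mem,
      h.quadric, smul_eq_mul, mul_zero, zero_add] at h1
    refine (mul_eq_zero.1 h1).resolve_right fun h1 => ?_
    simpa [h1] using h.c_mul_self
  subst hr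
  rw [zero_smul, add_zero] at hz
  have hs : s = 0 := by
    have h1 : flatWarped b ε a (Φ x) (ν x) (mvfderiv I Φ x u + s • ν x) = 0 := by
      rw [hz, map_zero]
    simp only [map_add, map_smul, h.normal, h.unit, smul_eq_mul, zero_add] at h1
    refine (mul_eq_zero.1 h1).resolve_right fun h1 => ?_
    simpa [h1] using h.delta_mul_self
  subst hs
  rw [zero_smul, add_zero] at hz
  exact ⟨h.nondegenerate x u fun w => by rw [h.metric, hz, map_zero]; rfl, rfl, rfl⟩

/-- The tangent space, the normal and the position vector span the ambient space. -/
lemma exists_decomposition (h : IsFlatHypersurface I b c ε δ a Φ ν g) (x : M) (w : ℝ × E) :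
    ∃ (u : TangentSpace I x) (s r : ℝ), w = mvfderiv I Φ x u + s • ν x + r • (0, (Φ x).2) := by
  let L : F × ℝ × ℝ →ₗ[ℝ] ℝ × E :=
    { toFun := fun z => (mvfderiv I Φ x : F → ℝ × E) z.1 + z.2.1 • ν x + z.2.2 • (0, (Φ x).2)
      map_add' := fun z z' => by
        have : (mvfderiv I Φ x : F → ℝ × E) (z.1 + z'.1)
          = (mvfderiv I Φ x : F → ℝ × E) z.1 + (mvfderiv I Φ x : F → ℝ × E) z'.1 := map_add _ _ _
        simp only [Prod.fst_add, Prod.snd_add, this, add_smul]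
        abel
      map_smul' := fun s z => by
        have : (mvfderiv I Φ x : F → ℝ × E) (s • z.1)
          = s • (mvfderiv I Φ x : F → ℝ × E) z.1 := map_smul _ _ _
        simp only [Prod.smul_fst, Prod.smul_snd, this, smul_eq_mul, smul_add, mul_smul,
          RingHom.id_apply] }
  have hL : ∀ (u : TangentSpace I x) (s r : ℝ),
      L ((u : F), s, r) = mvfderiv I Φ x u + s • ν x + r • (0, (Φ x).2) := fun _ _ _ => rfl
  have hinj : Function.Injective L := by
    refine (injective_iff_map_eq_zero L).2 ?_
    rintro ⟨u, s, r⟩ hz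
    obtain ⟨h1, h2, h3⟩ := h.eq_zero_of_combination (u := (u : TangentSpace I x))
      ((hL u s r).symm.trans hz)
    exact Prod.ext h1 (Prod.ext h2 h3)
  -- Injectivity and equality of dimensions give surjectivity: `M` has codimension two in `ℝ × E`.
  have hdim : Module.finrank ℝ (F × ℝ × ℝ) = Module.finrank ℝ (ℝ × E) := by
    simp [h.finrank_eq]; ring
  obtain ⟨⟨u, s, r⟩, hw⟩ := (LinearMap.injective_iff_surjective_of_finrank_eq_finrank hdim).1 hinj w
  exact ⟨u, s, r, hw.symm.trans (hL u s r)⟩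

/-- The three conditions kill in turn the component along the position vector, along `ν`, and along
`M`. This is the test by which vector identities below are proved. -/
lemma eq_zero_of_orthogonal (h : IsFlatHypersurface I b c ε δ a Φ ν g) {x : M} {w : ℝ × E}
    (h1 : b (Φ x).2 w.2 = 0) (h2 : ∀ u, flatWarped b ε a (Φ x) w (mvfderiv I Φ x u) = 0)
    (h3 : flatWarped b ε a (Φ x) w (ν x) = 0) : w = 0 := by
  obtain ⟨u, s, r, rfl⟩ := h.exists_decomposition x w
  have hr : r = 0 := by
    simp [h.form_mvfderiv x, h.normal_mem x, h.quadric x] at h1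
    rcases h1 with h1 | h1
    · exact h1
    · have := h.c_mul_self
      simp [h1] at this
  subst hr
  simp only [zero_smul, add_zero, map_add, add_apply, map_smul, smul_apply, h.unit,
    h.comm x _ (ν x), h.normal, smul_eq_mul, zero_add] at h2 h3
  have hs : s = 0 := by
    rcases mul_eq_zero.1 h3 with h3 | h3
    · exact h3
    · have := h.delta_mul_self
      simp [h3] at this
  subst hs
  have hu : u = 0 := h.nondegenerate x u fun w => by
    rw [h.metric]
    simpa using h2 w
  rw [hu]
  simp

variable [I.Boundaryless] [IsManifold I 1 M] [IsManifold I 2 M] [IsManifold I ∞ M]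

lemma mdifferentiableAt_mvfderiv (h : IsFlatHypersurface I b c ε δ a Φ ν g) {x : M}
    {Y : (y : M) → TangentSpace I y}
    (hY : MDifferentiableAt I 𝓘(ℝ, F) (principalPart I (fun y : M => y) Y x) x) :
    MDifferentiableAt I 𝓘(ℝ, ℝ × E) (fun y => mvfderiv I Φ y (Y y)) x :=
  (hasMFDerivAt_mvfderiv_apply (χ := fun y : M => y) (h.contMDiff_two x) mdifferentiableAt_id hY).1

lemma mdifferentiableAt_of_mvfderiv (h : IsFlatHypersurface I b c ε δ a Φ ν g) {x : M}
    {Y : (y : M) → TangentSpace I y}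
    (hY : MDifferentiableAt I 𝓘(ℝ, ℝ × E) (fun y => mvfderiv I Φ y (Y y)) x) :
    MDifferentiableAt I 𝓘(ℝ, F) (principalPart I (fun y : M => y) Y x) x :=
  mdifferentiableAt_principalPart h.contMDiff_two h.metric
    (hasFDerivAt_flatWarped (h.differentiableAt x)).differentiableAt (h.nondegenerate x) hY

lemma metric_leviCivita (h : IsFlatHypersurface I b c ε δ a Φ ν g) {x : M}
    {Y : (y : M) → TangentSpace I y}
    (hY : MDifferentiableAt I 𝓘(ℝ, F) (principalPart I (fun y : M => y) Y x) x)
    (v w : TangentSpace I x) :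
    g x (leviCivita g Y x v) w = flatWarped b ε a (Φ x)
      (flatCov I b c ε a Φ (fun y => mvfderiv I Φ y (Y y)) x v) (mvfderiv I Φ x w) :=
  metric_covDerivAlong_flatWarped h.symm h.eps_mul_self h.contMDiff_two h.metric
    (χ := fun y : M => y) (h.differentiableAt x) (h.ne_zero x) (h.form_mvfderiv x)
    (h.nondegenerate x) mdifferentiableAt_id hY v w

/-- The derivative of the product of two tangential fields. -/
lemma mvfderiv_product (h : IsFlatHypersurface I b c ε δ a Φ ν g) {x : M} {V U : M → ℝ × E}
    (hV : MDifferentiableAt I 𝓘(ℝ, ℝ × E) V x) (hU : MDifferentiableAt I 𝓘(ℝ, ℝ × E) U x)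
    (hVt : b (Φ x).2 (V x).2 = 0) (hUt : b (Φ x).2 (U x).2 = 0) (v : TangentSpace I x) :
    MDifferentiableAt I 𝓘(ℝ, ℝ) (fun y => flatWarped b ε a (Φ y) (V y) (U y)) x ∧
    mvfderiv I (fun y => flatWarped b ε a (Φ y) (V y) (U y)) x v
      = flatWarped b ε a (Φ x) (flatCov I b c ε a Φ V x v) (U x)
        + flatWarped b ε a (Φ x) (V x) (flatCov I b c ε a Φ U x v) :=
  mvfderiv_flatWarped h.symm h.eps_mul_self (h.differentiableAt x) (h.ne_zero x)
    (h.mdifferentiableAt x) hV hU hVt hUt v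

/-- The product `⟨ν, ν⟩ = δ` is constant. -/
lemma flatCov_normal_normal (h : IsFlatHypersurface I b c ε δ a Φ ν g) (x : M)
    (v : TangentSpace I x) :
    flatWarped b ε a (Φ x) (flatCov I b c ε a Φ ν x v) (ν x) = 0 := by
  have h1 := (h.mvfderiv_product (h.mdifferentiableAt_normal x) (h.mdifferentiableAt_normal x)
    (h.normal_mem x) (h.normal_mem x) v).2
  rw [show (fun y => flatWarped b ε a (Φ y) (ν y) (ν y)) = fun _ => δ from funext h.unit,
    mvfderiv_const, h.comm x (ν x)] at h1
  have h2 : (0 : TangentSpace I x →L[ℝ] ℝ) v = 0 := rfl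
  linarith

lemma form_flatCov_normal (h : IsFlatHypersurface I b c ε δ a Φ ν g) (x : M)
    (v : TangentSpace I x) : b (Φ x).2 (flatCov I b c ε a Φ ν x v).2 = 0 :=
  form_flatCov h.symm h.c_mul_self (h.mdifferentiableAt x) h.quadric (h.mdifferentiableAt_normal x)
    (Filter.Eventually.of_forall h.normal_mem) v

variable {A : (x : M) → TangentSpace I x → TangentSpace I x}

/-- The Weingarten formula. -/
lemma flatCov_normal (h : IsFlatHypersurface I b c ε δ a Φ ν g)
    (hA : ∀ x v w, g x (A x v) w
      = -flatWarped b ε a (Φ x) (flatCov I b c ε a Φ ν x v) (mvfderiv I Φ x w))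
    (x : M) (v : TangentSpace I x) :
    flatCov I b c ε a Φ ν x v = -mvfderiv I Φ x (A x v) := by
  refine eq_neg_of_add_eq_zero_left (h.eq_zero_of_orthogonal (x := x) ?_ (fun u => ?_) ?_)
  · rw [Prod.snd_add, map_add, h.form_mvfderiv, h.form_flatCov_normal, add_zero]
  · have := hA x v u
    rw [h.metric] at this
    rw [map_add, add_apply, this, add_neg_cancel]
  · rw [map_add, add_apply, h.flatCov_normal_normal, h.comm x _ (ν x), h.normal, add_zero]

/-- The Gauss formula. -/
lemma flatCov_mvfderiv (h : IsFlatHypersurface I b c ε δ a Φ ν g)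
    (hA : ∀ x v w, g x (A x v) w
      = -flatWarped b ε a (Φ x) (flatCov I b c ε a Φ ν x v) (mvfderiv I Φ x w))
    {x : M} {Y : (y : M) → TangentSpace I y}
    (hY : MDifferentiableAt I 𝓘(ℝ, F) (principalPart I (fun y : M => y) Y x) x)
    (v : TangentSpace I x) :
    flatCov I b c ε a Φ (fun y => mvfderiv I Φ y (Y y)) x v
      = mvfderiv I Φ x (leviCivita g Y x v) + (δ * g x (A x v) (Y x)) • ν x := by
  have hYd := h.mdifferentiableAt_mvfderiv hY
  refine sub_eq_zero.1 (h.eq_zero_of_orthogonal (x := x) ?_ (fun u => ?_) ?_)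
  · have := form_flatCov (ε := ε) (a := a) h.symm h.c_mul_self (h.mdifferentiableAt x) h.quadric hYd
      (Filter.Eventually.of_forall fun y => h.form_mvfderiv y (Y y)) v
    rw [Prod.snd_sub, map_sub, this, Prod.snd_add, map_add, h.form_mvfderiv, Prod.smul_snd,
      map_smul, h.normal_mem]
    simp
  · have := h.metric_leviCivita hY v u
    rw [h.metric] at this
    rw [map_sub, sub_apply, map_add, add_apply, this, map_smul, smul_apply, h.normal]
    simp
  -- Differentiating `⟨dΦ Y, ν⟩ = 0` turns `⟨D_v Y, ν⟩` into `-⟨Y, D_v ν⟩ = ⟨Y, A v⟩`; the factor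
  -- `δ` in the claim comes from `⟨ν, ν⟩ = δ`.
  · have h1 := (h.mvfderiv_product hYd (h.mdifferentiableAt_normal x) (h.form_mvfderiv x (Y x))
      (h.normal_mem x) v).2
    have h2 : (fun y => flatWarped b ε a (Φ y) (mvfderiv I Φ y (Y y)) (ν y)) = fun _ => 0 :=
      funext fun y => by rw [h.comm, h.normal]
    rw [h2, mvfderiv_const, h.flatCov_normal hA, map_neg, ← h.metric] at h1
    have h3 : (0 : TangentSpace I x →L[ℝ] ℝ) v = 0 := rfl
    rw [map_sub, sub_apply, map_add, add_apply, map_smul, smul_apply, h.unit,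
      h.comm x _ (ν x), h.comm x _ (ν x), h.normal, h.metric_comm x (A x v), smul_eq_mul]
    rw [h.comm] at h1
    linear_combination -h1 + h3 - g x (Y x) (A x v) * h.delta_mul_self

/-- `A` is a bare function known only through its products; its additivity is what the Codazzi
equation needs to split `A (∇_X Y)` by the torsion identity. -/
lemma shape_add (h : IsFlatHypersurface I b c ε δ a Φ ν g)
    (hA : ∀ x v w, g x (A x v) w
      = -flatWarped b ε a (Φ x) (flatCov I b c ε a Φ ν x v) (mvfderiv I Φ x w))
    (x : M) (u v : TangentSpace I x) : A x (u + v) = A x u + A x v :=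
  h.eq_of_metric fun w => by
    rw [map_add, add_apply, hA, hA, hA, flatCov_add_dir, map_add, add_apply, neg_add]

/-- The Levi-Civita connection has no torsion. -/
lemma leviCivita_sub (h : IsFlatHypersurface I b c ε δ a Φ ν g) {x : M}
    {X Y : (y : M) → TangentSpace I y}
    (hX : MDifferentiableAt I 𝓘(ℝ, F) (principalPart I (fun y : M => y) X x) x)
    (hY : MDifferentiableAt I 𝓘(ℝ, F) (principalPart I (fun y : M => y) Y x) x) :
    leviCivita g Y x (X x) - leviCivita g X x (Y x) = VectorField.mlieBracket I X Y x :=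
  h.eq_of_metric fun w => by
    rw [map_sub, sub_apply, h.metric_leviCivita hY, h.metric_leviCivita hX, ← sub_apply,
      ← map_sub, flatCov_mvfderiv_sub h.symm (h.contMDiff_two x) hX hY, ← h.metric]

/-- The extension is the field with constant principal part in the chart at `x`. -/
lemma exists_extension (x : M) (u : TangentSpace I x) :
    ∃ X : (y : M) → TangentSpace I y, X x = u ∧
      MDifferentiableAt I 𝓘(ℝ, F) (principalPart I (fun y : M => y) X x) x := by
  refine ⟨fun y => (mfderiv I 𝓘(ℝ, F) (extChartAt I x) y).inverse (u : F), ?_, ?_⟩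
  · have h1 : mfderiv I 𝓘(ℝ, F) (extChartAt I x) x = ContinuousLinearMap.id ℝ _ :=
      mfderiv_extChartAt_self (I := I) (x := x)
    have h2 : (mfderiv I 𝓘(ℝ, F) (extChartAt I x) x).IsInvertible :=
      isInvertible_mfderiv_extChartAt (mem_extChartAt_source x)
    have h3 := h2.self_apply_inverse (u : F)
    exact (congrArg (fun l : F →L[ℝ] F => l ((mfderiv I 𝓘(ℝ, F) (extChartAt I x) x).inverse
      (u : F))) h1).symm.trans h3
  · have : principalPart I (fun y : M => y)
        (fun y => (mfderiv I 𝓘(ℝ, F) (extChartAt I x) y).inverse (u : F)) x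
        =ᶠ[nhds x] fun _ => (u : F) := by
      filter_upwards [extChartAt_source_mem_nhds (I := I) x] with y hy
      exact (isInvertible_mfderiv_extChartAt hy).self_apply_inverse (u : F)
    exact mdifferentiableAt_const.congr_of_eventuallyEq this

/-- Symmetry of the second fundamental form: by the absence of torsion, `D_X Y - D_Y X` is the image
of a bracket and has no component along `ν`. -/
lemma metric_shape_comm (h : IsFlatHypersurface I b c ε δ a Φ ν g)
    (hA : ∀ x v w, g x (A x v) w
      = -flatWarped b ε a (Φ x) (flatCov I b c ε a Φ ν x v) (mvfderiv I Φ x w))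
    (x : M) (u v : TangentSpace I x) : g x (A x u) v = g x u (A x v) := by
  obtain ⟨X, rfl, hX⟩ := exists_extension x u
  obtain ⟨Y, rfl, hY⟩ := exists_extension x v
  have h1 := flatCov_mvfderiv_sub (c := c) (ε := ε) (a := a) h.symm (h.contMDiff_two x) hX hY
  rw [h.flatCov_mvfderiv hA hY, h.flatCov_mvfderiv hA hX] at h1
  have h2 := congrArg (fun z => flatWarped b ε a (Φ x) (ν x) z) h1
  simp only [map_sub, map_add, map_smul, h.normal, h.unit, smul_eq_mul, zero_add] at h2
  rw [h.metric_comm x (X x)]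
  linear_combination h2 - (g x (A x (X x)) (Y x) - g x (A x (Y x)) (X x)) * h.delta_mul_self

end IsFlatHypersurface
end Hypersurface

/-! ### Derivatives of `T` and `f`, and the Gauss and Codazzi equations. -/

section StructureEquations

namespace IsFlatHypersurface

variable {E F H : Type*} [NormedAddCommGroup E] [NormedSpace ℝ E]
  [NormedAddCommGroup F] [NormedSpace ℝ F] [TopologicalSpace H]
  [FiniteDimensional ℝ F] [FiniteDimensional ℝ E]
  {I : ModelWithCorners ℝ F H} {M : Type*} [TopologicalSpace M] [ChartedSpace H M]
  [I.Boundaryless] [IsManifold I 1 M] [IsManifold I 2 M] [IsManifold I ∞ M]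
  {b : E →L[ℝ] E →L[ℝ] ℝ} {c ε δ : ℝ} {a : ℝ → ℝ} {Φ ν : M → ℝ × E} {g : MetricField I M}
  {A : (x : M) → TangentSpace I x → TangentSpace I x}
  {T : (x : M) → TangentSpace I x} {f : M → ℝ}

/-- The decomposition `∂_t = T + f ν`. -/
lemma dt_eq (h : IsFlatHypersurface I b c ε δ a Φ ν g)
    (hT : ∀ x w, g x (T x) w = ε * (mvfderiv I Φ x w).1) (hf : ∀ x, f x = δ * (ε * (ν x).1))
    (x : M) : ((1 : ℝ), (0 : E)) = mvfderiv I Φ x (T x) + f x • ν x := by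
  refine sub_eq_zero.1 (h.eq_zero_of_orthogonal (x := x) ?_ (fun u => ?_) ?_)
  · rw [Prod.snd_sub, Prod.snd_add, Prod.smul_snd, map_sub, map_add, map_smul, h.form_mvfderiv,
      h.normal_mem]
    simp
  · rw [map_sub, sub_apply, flatWarped_dt, map_add, add_apply, ← h.metric, hT, map_smul,
      smul_apply, h.normal]
    simp
  · rw [map_sub, sub_apply, flatWarped_dt, map_add, add_apply, h.comm x _ (ν x), h.normal,
      map_smul, smul_apply, h.unit, hf, smul_eq_mul]
    linear_combination -ε * (ν x).1 * h.delta_mul_self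

/-- Both sides express `⟨dΦ v, ∂_t⟩` up to `ε`; the sign moves across since `ε² = 1`. -/
lemma mvfderiv_fst_eq (h : IsFlatHypersurface I b c ε δ a Φ ν g)
    (hT : ∀ x w, g x (T x) w = ε * (mvfderiv I Φ x w).1) (x : M) (v : TangentSpace I x) :
    (mvfderiv I Φ x v).1 = ε * g x v (T x) := by
  rw [h.metric_comm, hT]
  linear_combination -(mvfderiv I Φ x v).1 * h.eps_mul_self

/-- The derivative of `∂_t`. -/
lemma flatCov_dt (h : IsFlatHypersurface I b c ε δ a Φ ν g)
    (hT : ∀ x w, g x (T x) w = ε * (mvfderiv I Φ x w).1) (x : M) (v : TangentSpace I x) :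
    flatCov I b c ε a Φ (fun _ => ((1 : ℝ), (0 : E))) x v
      = (deriv a (Φ x).1 / a (Φ x).1)
        • (mvfderiv I Φ x v - (ε * g x v (T x)) • ((1 : ℝ), (0 : E))) := by
  have h0 : (0 : TangentSpace I x →L[ℝ] ℝ × E) v = 0 := rfl
  rw [flatCov, mvfderiv_const, h0, ← h.mvfderiv_fst_eq hT]
  refine Prod.ext ?_ ?_ <;> simp [warpedGamma]

lemma mdifferentiableAt_and_mvfderiv_normalPart (h : IsFlatHypersurface I b c ε δ a Φ ν g)
    (hf : ∀ x, f x = δ * (ε * (ν x).1)) (x : M) (v : TangentSpace I x) :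
    MDifferentiableAt I 𝓘(ℝ, ℝ) f x ∧
    mvfderiv I f x v
      = δ * (flatWarped b ε a (Φ x) (flatCov I b c ε a Φ (fun _ => ((1 : ℝ), (0 : E))) x v) (ν x)
        + flatWarped b ε a (Φ x) (1, 0) (flatCov I b c ε a Φ ν x v)) := by
  have h1 := h.mvfderiv_product (x := x) (V := fun _ => ((1 : ℝ), (0 : E)))
    mdifferentiableAt_const (h.mdifferentiableAt_normal x) (by simp) (h.normal_mem x) v
  have h2 := mvfderiv_comp_of_hasFDerivAt h1.1
    ((hasFDerivAt_id (𝕜 := ℝ) (flatWarped b ε a (Φ x) (1, 0) (ν x))).const_smul δ)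
  have h3 : f = fun y => δ • flatWarped b ε a (Φ y) (1, 0) (ν y) :=
    funext fun y => by rw [hf, flatWarped_dt, smul_eq_mul]
  have h4 := h2.2 v
  rw [h1.2] at h4
  rw [h3]
  exact ⟨h2.1, h4⟩

/-- The derivative of the normal part of `∂_t`. -/
lemma mvfderiv_normalPart (h : IsFlatHypersurface I b c ε δ a Φ ν g)
    (hA : ∀ x v w, g x (A x v) w
      = -flatWarped b ε a (Φ x) (flatCov I b c ε a Φ ν x v) (mvfderiv I Φ x w))
    (hT : ∀ x w, g x (T x) w = ε * (mvfderiv I Φ x w).1) (hf : ∀ x, f x = δ * (ε * (ν x).1))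
    (x : M) (v : TangentSpace I x) :
    mvfderiv I f x v = -δ * g x (A x (T x)) v
      - ε * (deriv a (Φ x).1 / a (Φ x).1) * g x v (T x) * f x := by
  rw [(h.mdifferentiableAt_and_mvfderiv_normalPart hf x v).2, h.flatCov_dt hT, h.flatCov_normal hA,
    flatWarped_dt, map_smul, map_sub, map_smul, smul_apply, sub_apply, smul_apply, flatWarped_dt,
    h.comm x _ (ν x), h.normal, Prod.fst_neg, h.mvfderiv_fst_eq hT, h.metric_shape_comm hA,
    h.metric_comm x v (A x (T x)), hf, smul_eq_mul, smul_eq_mul]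
  linear_combination -δ * g x (A x (T x)) v * h.eps_mul_self

lemma mvfderiv_tangentialPart (h : IsFlatHypersurface I b c ε δ a Φ ν g)
    (hT : ∀ x w, g x (T x) w = ε * (mvfderiv I Φ x w).1) (hf : ∀ x, f x = δ * (ε * (ν x).1)) :
    (fun x => mvfderiv I Φ x (T x))
      = fun x => ((1 : ℝ), (0 : E)) + (-f x) • ν x :=
  funext fun x => by
    rw [neg_smul, ← sub_eq_add_neg, h.dt_eq hT hf x, add_sub_cancel_right]

/-- The derivative of the tangential part of `∂_t`. -/
lemma leviCivita_tangentialPart (h : IsFlatHypersurface I b c ε δ a Φ ν g)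
    (hA : ∀ x v w, g x (A x v) w
      = -flatWarped b ε a (Φ x) (flatCov I b c ε a Φ ν x v) (mvfderiv I Φ x w))
    (hT : ∀ x w, g x (T x) w = ε * (mvfderiv I Φ x w).1) (hf : ∀ x, f x = δ * (ε * (ν x).1))
    (x : M) (v : TangentSpace I x) :
    leviCivita g T x v = (deriv a (Φ x).1 / a (Φ x).1) • (v - (ε * g x v (T x)) • T x)
      + f x • A x v := by
  have hfd : MDifferentiableAt I 𝓘(ℝ, ℝ) (fun y => -f y) x :=
    (h.mdifferentiableAt_and_mvfderiv_normalPart hf x v).1.neg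
  have hd : MDifferentiableAt I 𝓘(ℝ, ℝ × E) (fun y => (-f y) • ν y) x :=
    hfd.smul (h.mdifferentiableAt_normal x)
  -- Regularity of `T` is not assumed; it follows from `dΦ T = ∂_t - f ν`.
  have hTd : MDifferentiableAt I 𝓘(ℝ, ℝ × E) (fun x => mvfderiv I Φ x (T x)) x := by
    rw [h.mvfderiv_tangentialPart hT hf]
    exact mdifferentiableAt_const.add hd
  refine h.eq_of_metric fun w => ?_
  rw [h.metric_leviCivita (h.mdifferentiableAt_of_mvfderiv hTd), h.mvfderiv_tangentialPart hT hf,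
    flatCov_add mdifferentiableAt_const hd, flatCov_smul hfd (h.mdifferentiableAt_normal x),
    h.flatCov_dt hT, h.flatCov_normal hA]
  simp only [map_add, map_sub, map_smul, map_neg, add_apply, sub_apply, smul_apply, neg_apply,
    h.normal, ← h.metric, flatWarped_dt, hT, smul_eq_mul]
  ring

lemma flatWarped_curvature (h : IsFlatHypersurface I b c ε δ a Φ ν g)
    (x : M) (u w : TangentSpace I x) (v z : ℝ × E) :
    flatWarped b ε a (Φ x)
        (warpedCurvature b c ε a (Φ x) (mvfderiv I Φ x u) (mvfderiv I Φ x w) v) z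
      = (ε * (deriv a (Φ x).1) ^ 2 / (a (Φ x).1) ^ 2 - c / (a (Φ x).1) ^ 2)
          * (flatWarped b ε a (Φ x) (mvfderiv I Φ x u) v
              * flatWarped b ε a (Φ x) (mvfderiv I Φ x w) z
            - flatWarped b ε a (Φ x) (mvfderiv I Φ x w) v
              * flatWarped b ε a (Φ x) (mvfderiv I Φ x u) z)
        + (deriv (deriv a) (Φ x).1 / a (Φ x).1 - (deriv a (Φ x).1) ^ 2 / (a (Φ x).1) ^ 2
            + ε * c / (a (Φ x).1) ^ 2)
          * (flatWarped b ε a (Φ x) (mvfderiv I Φ x u) v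
              * (ε * (mvfderiv I Φ x w).1) * (ε * z.1)
            - flatWarped b ε a (Φ x) (mvfderiv I Φ x w) v
              * (ε * (mvfderiv I Φ x u).1) * (ε * z.1)
            - flatWarped b ε a (Φ x) (mvfderiv I Φ x u) z
              * (ε * (mvfderiv I Φ x w).1) * (ε * v.1)
            + flatWarped b ε a (Φ x) (mvfderiv I Φ x w) z
              * (ε * (mvfderiv I Φ x u).1) * (ε * v.1)) :=
  flatWarped_warpedCurvature h.symm h.eps_mul_self (h.ne_zero x) (h.form_mvfderiv x u)
    (h.form_mvfderiv x w)

/-- The second covariant derivative in terms of that of the ambient space. -/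
lemma metric_leviCivita_leviCivita (h : IsFlatHypersurface I b c ε δ a Φ ν g)
    (hA : ∀ x v w, g x (A x v) w
      = -flatWarped b ε a (Φ x) (flatCov I b c ε a Φ ν x v) (mvfderiv I Φ x w))
    {x : M} {Y Z : (y : M) → TangentSpace I y} (hY : SmoothFieldAt Y x) (hZ : SmoothFieldAt Z x)
    (v w : TangentSpace I x) :
    g x (leviCivita g (fun y => leviCivita g Z y (Y y)) x v) w
      = flatWarped b ε a (Φ x)
          (flatCov I b c ε a Φ (fun y => flatCov I b c ε a Φ (fun y => mvfderiv I Φ y (Z y)) y (Y y))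
            x v) (mvfderiv I Φ x w)
        + δ * g x (A x (Y x)) (Z x) * g x (A x v) w := by
  have hYd := SmoothAlongAt.mdifferentiableAt_principalPart hY
  have hZd := SmoothAlongAt.mdifferentiableAt_principalPart hZ
  have hZs : ContMDiffAt I 𝓘(ℝ, ℝ × E) 2 (fun y => mvfderiv I Φ y (Z y)) x :=
    (SmoothAlongAt.contMDiffAt_mvfderiv_apply hZ (h.smooth x)).of_le ENat.LEInfty.out
  have h1 : MDifferentiableAt I 𝓘(ℝ, ℝ × E)
      (fun y => flatCov I b c ε a Φ (fun y => mvfderiv I Φ y (Z y)) y (Y y)) x :=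
    mdifferentiableAt_flatCov (h.contDiffAt x) (h.ne_zero x) (h.contMDiff_two x) hZs hYd
  have h2 : MDifferentiableAt I 𝓘(ℝ, ℝ × E) (fun y => flatCov I b c ε a Φ ν y (Y y)) x :=
    mdifferentiableAt_flatCov (h.contDiffAt x) (h.ne_zero x) (h.contMDiff_two x)
      (h.contMDiff_two_normal x) hYd
  have h3 := (h.mvfderiv_product h2 (h.mdifferentiableAt_mvfderiv hZd)
    (h.form_flatCov_normal x (Y x)) (h.form_mvfderiv x (Z x)) v).1
  -- By the characterization of `A`, this function is `δ ⟨D_Y ν, dΦ Z⟩`, a product of differentiable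
  -- fields.
  have h4 : MDifferentiableAt I 𝓘(ℝ, ℝ) (fun y => -(δ * g y (A y (Y y)) (Z y))) x := by
    have := (mvfderiv_comp_of_hasFDerivAt h3
      ((hasFDerivAt_id (𝕜 := ℝ) _).const_smul δ)).1
    refine this.congr_of_eventuallyEq (Filter.Eventually.of_forall fun y => ?_)
    simp [hA]
  have h5 : (fun y => mvfderiv I Φ y (leviCivita g Z y (Y y))) =ᶠ[nhds x]
      fun y => flatCov I b c ε a Φ (fun y => mvfderiv I Φ y (Z y)) y (Y y)
        + (-(δ * g y (A y (Y y)) (Z y))) • ν y := by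
    filter_upwards [SmoothAlongAt.eventually_mdifferentiableAt hZ] with y hy
    rw [h.flatCov_mvfderiv hA hy, neg_smul, add_neg_cancel_right]
  have h6 : MDifferentiableAt I 𝓘(ℝ, ℝ × E)
      (fun y => (-(δ * g y (A y (Y y)) (Z y))) • ν y) x :=
    h4.smul (h.mdifferentiableAt_normal x)
  have h7 : MDifferentiableAt I 𝓘(ℝ, ℝ × E)
      (fun y => mvfderiv I Φ y (leviCivita g Z y (Y y))) x :=
    (h1.add h6).congr_of_eventuallyEq h5
  -- Differentiating the normal term yields a multiple of `ν`, which disappears against `dΦ w`, and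
  -- a multiple of `D_v ν = -dΦ (A v)`, which gives the quadratic term in `A`.
  rw [h.metric_leviCivita (h.mdifferentiableAt_of_mvfderiv h7), flatCov_congr h5,
    flatCov_add h1 h6, flatCov_smul h4 (h.mdifferentiableAt_normal x), h.flatCov_normal hA,
    map_add, add_apply, map_add, add_apply, map_smul, map_smul, smul_apply, smul_apply, h.normal,
    map_neg, neg_apply, ← h.metric, smul_eq_mul, smul_eq_mul]
  ring

/-- The Gauss equation. -/
lemma gauss (h : IsFlatHypersurface I b c ε δ a Φ ν g)
    (hA : ∀ x v w, g x (A x v) w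
      = -flatWarped b ε a (Φ x) (flatCov I b c ε a Φ ν x v) (mvfderiv I Φ x w))
    (hT : ∀ x w, g x (T x) w = ε * (mvfderiv I Φ x w).1)
    {x : M} {X Y Z : (y : M) → TangentSpace I y} (hX : SmoothFieldAt X x)
    (hY : SmoothFieldAt Y x) (hZ : SmoothFieldAt Z x) (w : TangentSpace I x) :
    g x (curvature g X Y Z x) w
      = (ε * (deriv a (Φ x).1) ^ 2 / (a (Φ x).1) ^ 2 - c / (a (Φ x).1) ^ 2)
          * (g x (X x) (Z x) * g x (Y x) w - g x (Y x) (Z x) * g x (X x) w)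
        + (deriv (deriv a) (Φ x).1 / a (Φ x).1 - (deriv a (Φ x).1) ^ 2 / (a (Φ x).1) ^ 2
            + ε * c / (a (Φ x).1) ^ 2)
          * (g x (X x) (Z x) * g x (Y x) (T x) * g x w (T x)
            - g x (Y x) (Z x) * g x (X x) (T x) * g x w (T x)
            - g x (X x) w * g x (Y x) (T x) * g x (Z x) (T x)
            + g x (Y x) w * g x (X x) (T x) * g x (Z x) (T x))
        + δ * (g x (A x (Y x)) (Z x) * g x (A x (X x)) w
            - g x (A x (Y x)) w * g x (A x (X x)) (Z x)) := by
  have hXd := SmoothAlongAt.mdifferentiableAt_principalPart hX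
  have hYd := SmoothAlongAt.mdifferentiableAt_principalPart hY
  have hZd := SmoothAlongAt.mdifferentiableAt_principalPart hZ
  have hZs : ContMDiffAt I 𝓘(ℝ, ℝ × E) 2 (fun y => mvfderiv I Φ y (Z y)) x :=
    (SmoothAlongAt.contMDiffAt_mvfderiv_apply hZ (h.smooth x)).of_le ENat.LEInfty.out
  have hR := flatCov_flatCov_sub (b := b) (c := c) (ε := ε) (h.contDiffAt x) (h.ne_zero x)
    (h.contMDiff_two x) hZs hXd hYd
  have hR' := congrArg (fun z => flatWarped b ε a (Φ x) z (mvfderiv I Φ x w)) hR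
  simp only [map_sub, sub_apply] at hR'
  rw [h.flatWarped_curvature] at hR'
  simp only [← h.metric, ← hT] at hR'
  rw [curvature, map_sub, map_sub, sub_apply, sub_apply,
    h.metric_leviCivita_leviCivita hA hY hZ, h.metric_leviCivita_leviCivita hA hX hZ,
    h.metric_leviCivita hZd]
  simp only [h.metric_comm x _ (T x)]
  linear_combination hR'

/-- The Codazzi equation. -/
lemma codazzi (h : IsFlatHypersurface I b c ε δ a Φ ν g)
    (hA : ∀ x v w, g x (A x v) w
      = -flatWarped b ε a (Φ x) (flatCov I b c ε a Φ ν x v) (mvfderiv I Φ x w))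
    (hT : ∀ x w, g x (T x) w = ε * (mvfderiv I Φ x w).1) (hf : ∀ x, f x = δ * (ε * (ν x).1))
    {x : M} {X Y : (y : M) → TangentSpace I y} (hX : SmoothFieldAt X x)
    (hY : SmoothFieldAt Y x) :
    covDerivEnd g A X Y x - covDerivEnd g A Y X x
      = (δ * f x * (deriv (deriv a) (Φ x).1 / a (Φ x).1
            - (deriv a (Φ x).1) ^ 2 / (a (Φ x).1) ^ 2 + ε * c / (a (Φ x).1) ^ 2))
          • (g x (Y x) (T x) • X x - g x (X x) (T x) • Y x) := by
  have hXd := SmoothAlongAt.mdifferentiableAt_principalPart hX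
  have hYd := SmoothAlongAt.mdifferentiableAt_principalPart hY
  have key : ∀ {X : (y : M) → TangentSpace I y},
      MDifferentiableAt I 𝓘(ℝ, F) (principalPart I (fun y : M => y) X x) x →
      ∀ v w : TangentSpace I x, g x (leviCivita g (fun y => A y (X y)) x v) w
        = -flatWarped b ε a (Φ x) (flatCov I b c ε a Φ
            (fun y => flatCov I b c ε a Φ ν y (X y)) x v) (mvfderiv I Φ x w) := by
    -- The Weingarten formula identifies `dΦ (A X)` with `-D_X ν`, so second derivatives of `ν`
    -- replace derivatives of `A`.
    intro X hX v w
    have h1 : MDifferentiableAt I 𝓘(ℝ, ℝ × E) (fun y => flatCov I b c ε a Φ ν y (X y)) x :=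
      mdifferentiableAt_flatCov (h.contDiffAt x) (h.ne_zero x) (h.contMDiff_two x)
        (h.contMDiff_two_normal x) hX
    have h2 : (fun y => mvfderiv I Φ y (A y (X y)))
        = fun y => -flatCov I b c ε a Φ ν y (X y) :=
      funext fun y => by rw [h.flatCov_normal hA, neg_neg]
    have h3 : MDifferentiableAt I 𝓘(ℝ, ℝ × E) (fun y => mvfderiv I Φ y (A y (X y))) x := by
      rw [h2]
      exact h1.neg
    rw [h.metric_leviCivita (h.mdifferentiableAt_of_mvfderiv h3), h2, flatCov_neg, map_neg,
      neg_apply]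
  have hR := flatCov_flatCov_sub (b := b) (c := c) (ε := ε) (h.contDiffAt x) (h.ne_zero x)
    (h.contMDiff_two x) (h.contMDiff_two_normal x) hXd hYd
  have hfx : ε * (ν x).1 = δ * f x := by
    rw [hf]
    linear_combination -ε * (ν x).1 * h.delta_mul_self
  have htor : A x (leviCivita g Y x (X x)) = A x (leviCivita g X x (Y x))
      + A x (VectorField.mlieBracket I X Y x) := by
    rw [← h.shape_add hA, ← h.leviCivita_sub hXd hYd, add_sub_cancel]
  refine h.eq_of_metric fun w => ?_
  have hR' := congrArg (fun z => flatWarped b ε a (Φ x) z (mvfderiv I Φ x w)) hR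
  simp only [map_sub, sub_apply] at hR'
  -- With `ν` in the third slot, the constant curvature part and two of the four terms in `κ`
  -- vanish; the other two carry `⟨∂_t, ν⟩ = δ f`.
  rw [h.flatWarped_curvature, h.comm x _ (ν x), h.comm x _ (ν x), h.normal, h.normal, hfx] at hR'
  simp only [← h.metric, ← hT] at hR'
  have hbr := hA x (VectorField.mlieBracket I X Y x) w
  rw [covDerivEnd, covDerivEnd, htor]
  simp only [map_sub, map_add, map_smul, sub_apply, add_apply, smul_apply, smul_eq_mul,
    key hYd, key hXd, h.metric_comm x _ (T x)]
  linear_combination -hR' - hbr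

end IsFlatHypersurface
end StructureEquations

/-! ### Non-degenerate immersions with a unit normal. -/

section Immersion

variable {E F H K : Type*} [NormedAddCommGroup E] [NormedSpace ℝ E] [TopologicalSpace H]
  [NormedAddCommGroup F] [NormedSpace ℝ F] [TopologicalSpace K]
  [FiniteDimensional ℝ E] [FiniteDimensional ℝ F]
  {I : ModelWithCorners ℝ E H} {J : ModelWithCorners ℝ F K}
  {M : Type*} [TopologicalSpace M] [ChartedSpace H M]
  {N : Type*} [TopologicalSpace N] [ChartedSpace K N]
  {g : MetricField J N} {χ : M → N}

lemma IsNondegenerateImmersion.metric_tangentialPart (hχ : IsNondegenerateImmersion I g χ) (x : M)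
    (w : TangentSpace J (χ x)) (v : TangentSpace I x) :
    pullbackMetric I g χ x (tangentialPart I g χ x w) v = g (χ x) w (mfderiv I J χ x v) := by
  have h1 : (pullbackMetric I g χ x : E →L[ℝ] E →L[ℝ] ℝ).IsInvertible :=
    isInvertible_of_nondegenerate (F := E) (hχ.nondegenerate x)
  exact congrArg (fun l : E →L[ℝ] ℝ => l v)
    (h1.self_apply_inverse ((g (χ x) w).comp (mfderiv I J χ x)))

/-- A metric is non-degenerate along a non-degenerate hypersurface with a unit normal. -/
lemma IsNondegenerateImmersion.nondegenerate_ambient [IsManifold J 1 N]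
    (hχ : IsNondegenerateImmersion I g χ) {ν : (y : M) → TangentSpace J (χ y)} {δ : ℝ}
    (hν : IsUnitNormal I g χ ν δ) (hδ : δ ≠ 0)
    (hdim : Module.finrank ℝ F = Module.finrank ℝ E + 1)
    (x : M) (u : TangentSpace J (χ x)) (hu : ∀ w, g (χ x) u w = 0) : u = 0 := by
  have key : ∀ (v : TangentSpace I x) (s : ℝ), mfderiv I J χ x v + s • ν x = 0 →
      v = 0 ∧ s = 0 := by
    intro v s hz
    have hs : s = 0 := by
      have h1 : g (χ x) (ν x) (mfderiv I J χ x v + s • ν x) = 0 := by rw [hz, map_zero]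
      rw [map_add, hν.normal, map_smul, hν.unit, zero_add, smul_eq_mul] at h1
      exact (mul_eq_zero.1 h1).resolve_right hδ
    subst hs
    rw [zero_smul, add_zero] at hz
    exact ⟨hχ.injective_mfderiv x (hz.trans (map_zero _).symm), rfl⟩
  let D : E →L[ℝ] F := mfderiv I J χ x
  let m : F := ν x
  let L : E × ℝ →ₗ[ℝ] F :=
    (D.comp (ContinuousLinearMap.fst ℝ E ℝ)
      + (ContinuousLinearMap.snd ℝ E ℝ).smulRight m).toLinearMap
  have hinj : Function.Injective L := by
    refine (injective_iff_map_eq_zero L).2 ?_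
    rintro ⟨v, s⟩ hz
    obtain ⟨h1, h2⟩ := key v s hz
    exact Prod.ext h1 h2
  -- By dimension, `dχ (T_x M)` and `ν` span the ambient tangent space, and the metric is
  -- non-degenerate on each of these orthogonal summands. Thus the signature of the space form is
  -- not needed.
  have hfr : Module.finrank ℝ (E × ℝ) = Module.finrank ℝ F := by simp [hdim]
  obtain ⟨⟨v, s⟩, hw⟩ :=
    (LinearMap.injective_iff_surjective_of_finrank_eq_finrank hfr).1 hinj (u : F)
  have hu' : mfderiv I J χ x (v : TangentSpace I x) + s • ν x = u := hw
  have h1 : v = (0 : E) := hχ.nondegenerate x v fun w => by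
    have := hu (mfderiv I J χ x w)
    rw [← hu', map_add, add_apply, map_smul, smul_apply, hν.normal, smul_zero, add_zero] at this
    exact this
  have h2 : s = 0 := by
    have := hu (ν x)
    rw [← hu', map_add, add_apply, map_smul, smul_apply, hν.unit, smul_eq_mul] at this
    have h3 : mfderiv I J χ x (v : TangentSpace I x) = 0 :=
      (congrArg (fun v : E => (mfderiv I J χ x : E → F) v) h1).trans (map_zero _)
    rw [h3, map_zero] at this
    refine (mul_eq_zero.1 (Eq.trans ?_ this)).resolve_right hδ
    exact (zero_add _).symm
  have h3 : mfderiv I J χ x (v : TangentSpace I x) = 0 :=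
    (congrArg (fun v : E => (mfderiv I J χ x : E → F) v) h1).trans (map_zero _)
  rw [← hu', h3, h2, zero_smul, add_zero]

end Immersion

/-! ### Transfer from the warped product to the flat picture. -/

section WarpedProduct

variable {n k : ℕ} {c : ℤˣ} {I₀ : TopologicalSpace.Opens ℝ} {ε δ : ℝ} {a : ℝ → ℝ}
  {M : Type*} [TopologicalSpace M] [ChartedSpace (EuclideanSpace ℝ (Fin n)) M]
  [IsManifold (𝓡 n) ∞ M] {χ : M → I₀ × SpaceForm n k c}
  {ν : (x : M) → TangentSpace (𝓘(ℝ, ℝ).prod (𝓡 n)) (χ x)}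

lemma mvfderiv_toFlat_comp {x : M}
    (hχ : MDifferentiableAt (𝓡 n) (𝓘(ℝ, ℝ).prod (𝓡 n)) χ x) (v : TangentSpace (𝓡 n) x) :
    mvfderiv (𝓡 n) (fun y => toFlat (χ y)) x v
      = mvfderiv (𝓘(ℝ, ℝ).prod (𝓡 n)) toFlat (χ x)
        (mfderiv (𝓡 n) (𝓘(ℝ, ℝ).prod (𝓡 n)) χ x v) :=
  mfderiv_comp_apply x ((contMDiff_toFlat (χ x)).mdifferentiableAt (by simp)) hχ v

lemma isFlatHypersurface (hε : ε * ε = 1) (hδ : δ * δ = 1) (ha : ContDiffOn ℝ ∞ a I₀)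
    (ha_pos : ∀ t ∈ I₀, 0 < a t)
    (hχ : IsNondegenerateImmersion (𝓡 n) (warpedMetric ε I₀ a (SpaceForm.metric n k c)) χ)
    (hν : IsUnitNormal (𝓡 n) (warpedMetric ε I₀ a (SpaceForm.metric n k c)) χ ν δ) :
    IsFlatHypersurface (𝓡 n) (ambientForm n k c) (signR c) ε δ a (fun x => toFlat (χ x))
      (fun x => mvfderiv (𝓘(ℝ, ℝ).prod (𝓡 n)) toFlat (χ x) (ν x))
      (pullbackMetric (𝓡 n) (warpedMetric ε I₀ a (SpaceForm.metric n k c)) χ) where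
  symm := flatForm_comm _ _
  c_mul_self := signR_mul_self c
  eps_mul_self := hε
  delta_mul_self := hδ
  contDiffAt x := ((ha _ (χ x).1.2).contDiffAt (I₀.isOpen.mem_nhds (χ x).1.2)).of_le
    ENat.LEInfty.out
  ne_zero x := (ha_pos _ (χ x).1.2).ne'
  smooth := contMDiff_toFlat.comp hχ.smooth
  smooth_normal x := SmoothAlongAt.contMDiffAt_mvfderiv_apply (hν.smooth x) (contMDiff_toFlat _)
  quadric x := (χ x).2.form_self
  normal_mem x := form_mvfderiv_toFlat _ _
  metric x u w := by
    rw [pullbackMetric_apply, warpedMetric_eq,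
      mvfderiv_toFlat_comp ((hχ.smooth x).mdifferentiableAt (by simp)),
      mvfderiv_toFlat_comp ((hχ.smooth x).mdifferentiableAt (by simp))]
  normal x u := by
    rw [mvfderiv_toFlat_comp ((hχ.smooth x).mdifferentiableAt (by simp)), ← warpedMetric_eq,
      hν.normal]
  unit x := by rw [← warpedMetric_eq, hν.unit]
  nondegenerate := hχ.nondegenerate
  finrank_eq := by simp

/-- The covariant derivative along `χ`, seen in `ℝ × 𝔼ⁿ⁺¹`. -/
lemma mvfderiv_toFlat_covDerivAlong (hε : ε * ε = 1) (hδ : δ * δ = 1) (ha : ContDiffOn ℝ ∞ a I₀)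
    (ha_pos : ∀ t ∈ I₀, 0 < a t)
    (hχ : IsNondegenerateImmersion (𝓡 n) (warpedMetric ε I₀ a (SpaceForm.metric n k c)) χ)
    (hν : IsUnitNormal (𝓡 n) (warpedMetric ε I₀ a (SpaceForm.metric n k c)) χ ν δ)
    {V : (y : M) → TangentSpace (𝓘(ℝ, ℝ).prod (𝓡 n)) (χ y)} {x : M}
    (hV : MDifferentiableAt (𝓡 n) 𝓘(ℝ, ℝ × EuclideanSpace ℝ (Fin n))
      (principalPart (𝓘(ℝ, ℝ).prod (𝓡 n)) χ V x) x) (v : TangentSpace (𝓡 n) x) :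
    mvfderiv (𝓘(ℝ, ℝ).prod (𝓡 n)) toFlat (χ x)
        (covDerivAlong (warpedMetric ε I₀ a (SpaceForm.metric n k c)) χ V x v)
      = flatCov (𝓡 n) (ambientForm n k c) (signR c) ε a (fun y => toFlat (χ y))
        (fun y => mvfderiv (𝓘(ℝ, ℝ).prod (𝓡 n)) toFlat (χ y) (V y)) x v := by
  have h := isFlatHypersurface hε hδ ha ha_pos hχ hν
  have hδ0 : δ ≠ 0 := by rintro rfl; simp at hδ
  have hχd : MDifferentiableAt (𝓡 n) (𝓘(ℝ, ℝ).prod (𝓡 n)) χ x :=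
    (hχ.smooth x).mdifferentiableAt (by simp)
  have hd := (hasMFDerivAt_mvfderiv_apply
    ((contMDiff_toFlat (χ x)).of_le ENat.LEInfty.out) hχd hV).1
  have key := metric_covDerivAlong_flatWarped (c := signR c) h.symm hε
    (contMDiff_toFlat.of_le ENat.LEInfty.out)
    (fun q u w => warpedMetric_eq ε a q u w) (h.differentiableAt x) (h.ne_zero x)
    (fun w => form_mvfderiv_toFlat _ w)
    (hχ.nondegenerate_ambient hν hδ0 (by simp [add_comm]) x) hχd hV v
  simp only [warpedMetric_eq] at key
  -- Both sides are tangent to the cylinder and have the same products with every vector tangent to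
  -- the warped product, hence with `dΦ u` and `ν`.
  refine sub_eq_zero.1 (h.eq_zero_of_orthogonal (x := x) ?_ (fun u => ?_) ?_)
  · rw [Prod.snd_sub, map_sub]
    exact (congrArg₂ (· - ·) (form_mvfderiv_toFlat _ _)
      (form_flatCov h.symm h.c_mul_self (h.mdifferentiableAt x) h.quadric hd
        (Filter.Eventually.of_forall fun y => form_mvfderiv_toFlat _ _) v)).trans (sub_zero 0)
  · rw [mvfderiv_toFlat_comp hχd, map_sub, sub_apply, key, sub_self]
  · rw [map_sub, sub_apply, key, sub_self]

/-- The flat image of `∂_t` is constant, so `∂_t` is differentiable on the warped product at `χ x`;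
composing with `χ` finishes. -/
lemma mdifferentiableAt_principalPart_dt (hε : ε * ε = 1) (hδ : δ * δ = 1)
    (ha : ContDiffOn ℝ ∞ a I₀) (ha_pos : ∀ t ∈ I₀, 0 < a t)
    (hχ : IsNondegenerateImmersion (𝓡 n) (warpedMetric ε I₀ a (SpaceForm.metric n k c)) χ)
    (hν : IsUnitNormal (𝓡 n) (warpedMetric ε I₀ a (SpaceForm.metric n k c)) χ ν δ) (x : M) :
    MDifferentiableAt (𝓡 n) 𝓘(ℝ, ℝ × EuclideanSpace ℝ (Fin n))
      (principalPart (𝓘(ℝ, ℝ).prod (𝓡 n)) χ (fun y => dt (𝓡 n) (χ y)) x) x := by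
  have h := isFlatHypersurface hε hδ ha ha_pos hχ hν
  have hδ0 : δ ≠ 0 := by rintro rfl; simp at hδ
  have h1 : MDifferentiableAt (𝓘(ℝ, ℝ).prod (𝓡 n)) 𝓘(ℝ, ℝ × EuclideanSpace ℝ (Fin n))
      (principalPart (𝓘(ℝ, ℝ).prod (𝓡 n)) (fun q : I₀ × SpaceForm n k c => q)
        (fun q => dt (𝓡 n) q) (χ x)) (χ x) := by
    refine mdifferentiableAt_principalPart (contMDiff_toFlat.of_le ENat.LEInfty.out)
      (fun q u w => warpedMetric_eq ε a q u w)
      (hasFDerivAt_flatWarped (h.differentiableAt x)).differentiableAt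
      (hχ.nondegenerate_ambient hν hδ0 (by simp [add_comm]) x) ?_
    simp only [mvfderiv_toFlat_dt]
    exact mdifferentiableAt_const
  exact h1.comp x ((hχ.smooth x).mdifferentiableAt (by simp))

/-- A vector in the kernel is orthogonal to everything, since the metric factors through the
differential. Equalities of ambient tangent vectors can therefore be verified in `ℝ × 𝔼ⁿ⁺¹`. -/
lemma mvfderiv_toFlat_injective (hδ : δ * δ = 1)
    (hχ : IsNondegenerateImmersion (𝓡 n) (warpedMetric ε I₀ a (SpaceForm.metric n k c)) χ)
    (hν : IsUnitNormal (𝓡 n) (warpedMetric ε I₀ a (SpaceForm.metric n k c)) χ ν δ) (x : M) :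
    Function.Injective (mvfderiv (𝓘(ℝ, ℝ).prod (𝓡 n)) toFlat (χ x)) := by
  have hδ0 : δ ≠ 0 := by rintro rfl; simp at hδ
  refine (injective_iff_map_eq_zero _).2 fun u hu =>
    hχ.nondegenerate_ambient hν hδ0 (by simp [add_comm]) x u fun w => ?_
  rw [warpedMetric_eq, hu, map_zero]
  rfl

end WarpedProduct

end WarpedHypersurface

open WarpedHypersurface in
theorem mainTheorem6
    -- the warped product `P̄ = ε I₀ ×_a 𝕄ⁿ_k(c)`
    (n k : ℕ) (hn : 2 ≤ n) (hk : k ≤ n) (c : ℤˣ)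
    (ε : ℝ) (hε : ε = 1 ∨ ε = -1)
    (I₀ : TopologicalSpace.Opens ℝ) (hI₀ : (I₀ : Set ℝ).OrdConnected)
    (a : ℝ → ℝ) (ha : ContDiffOn ℝ ∞ a I₀) (ha_pos : ∀ t ∈ I₀, 0 < a t)
    -- the metric of `P̄`
    (gbar : MetricField (𝓘(ℝ, ℝ).prod (𝓡 n)) (I₀ × SpaceForm n k c))
    (hgbar : gbar = warpedMetric ε I₀ a (SpaceForm.metric n k c))
    -- the non-degenerate hypersurface `χ : M → P̄`, its induced metric and its unit normal
    {M : Type*} [TopologicalSpace M] [ChartedSpace (EuclideanSpace ℝ (Fin n)) M]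
    [IsManifold (𝓡 n) ∞ M]
    (χ : M → I₀ × SpaceForm n k c) (hχ : IsNondegenerateImmersion (𝓡 n) gbar χ)
    (g : MetricField (𝓡 n) M) (hg : g = pullbackMetric (𝓡 n) gbar χ)
    (ν : (x : M) → TangentSpace (𝓘(ℝ, ℝ).prod (𝓡 n)) (χ x))
    (δ : ℝ) (hδ : δ = 1 ∨ δ = -1) (hν : IsUnitNormal (𝓡 n) gbar χ ν δ)
    -- the shape operator, the tangential part of `∂_t`, and its normal coordinate
    (A : (x : M) → TangentSpace (𝓡 n) x → TangentSpace (𝓡 n) x)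
    (hA : A = shapeOperator (𝓡 n) gbar χ ν)
    (T : (x : M) → TangentSpace (𝓡 n) x)
    (hT : T = fun x => tangentialPart (𝓡 n) gbar χ x (dt (𝓡 n) (χ x)))
    (f : M → ℝ) (hf : f = fun x => δ * gbar (χ x) (dt (𝓡 n) (χ x)) (ν x))
    -- the coefficients along the hypersurface
    (α α' α'' κ : M → ℝ)
    (hα : α = fun x => a (χ x).1) (hα' : α' = fun x => deriv a (χ x).1)
    (hα'' : α'' = fun x => deriv (deriv a) (χ x).1)
    (hκ : κ = fun x => α'' x / α x - (α' x) ^ 2 / (α x) ^ 2 + ε * signR c / (α x) ^ 2) :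
    -- `∂_t = T + f ν` and `∇̄_v ν = - A v`
    (∀ x, dt (𝓡 n) (χ x) = mfderiv (𝓡 n) (𝓘(ℝ, ℝ).prod (𝓡 n)) χ x (T x) + f x • ν x) ∧
    (∀ x (v : TangentSpace (𝓡 n) x), covDerivAlong gbar χ ν x v
      = -mfderiv (𝓡 n) (𝓘(ℝ, ℝ).prod (𝓡 n)) χ x (A x v)) ∧
    -- the Gauss equation
    (∀ (x : M) (X Y Z W : (y : M) → TangentSpace (𝓡 n) y),
      SmoothFieldAt X x → SmoothFieldAt Y x → SmoothFieldAt Z x →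
      g x (curvature g X Y Z x) (W x)
        = (ε * (α' x) ^ 2 / (α x) ^ 2 - signR c / (α x) ^ 2)
            * (g x (X x) (Z x) * g x (Y x) (W x) - g x (Y x) (Z x) * g x (X x) (W x))
          + κ x
            * (g x (X x) (Z x) * g x (Y x) (T x) * g x (W x) (T x)
              - g x (Y x) (Z x) * g x (X x) (T x) * g x (W x) (T x)
              - g x (X x) (W x) * g x (Y x) (T x) * g x (Z x) (T x)
              + g x (Y x) (W x) * g x (X x) (T x) * g x (Z x) (T x))
          + δ * (g x (A x (Y x)) (Z x) * g x (A x (X x)) (W x)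
              - g x (A x (Y x)) (W x) * g x (A x (X x)) (Z x))) ∧
    -- the Codazzi equation
    (∀ (x : M) (X Y : (y : M) → TangentSpace (𝓡 n) y),
      SmoothFieldAt X x → SmoothFieldAt Y x →
      covDerivEnd g A X Y x - covDerivEnd g A Y X x
        = (δ * f x * κ x) • (g x (Y x) (T x) • X x - g x (X x) (T x) • Y x)) ∧
    -- the derivatives of `∂_t`, `T` and `f`
    (∀ x (v : TangentSpace (𝓡 n) x), covDerivAlong gbar χ (fun y => dt (𝓡 n) (χ y)) x v
      = (α' x / α x) • (mfderiv (𝓡 n) (𝓘(ℝ, ℝ).prod (𝓡 n)) χ x v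
          - (ε * g x v (T x)) • dt (𝓡 n) (χ x))) ∧
    (∀ x (v : TangentSpace (𝓡 n) x), leviCivita g T x v
      = (α' x / α x) • (v - (ε * g x v (T x)) • T x) + f x • A x v) ∧
    (∀ x (v : TangentSpace (𝓡 n) x), mvfderiv (𝓡 n) f x v
      = -δ * g x (A x (T x)) v - ε * (α' x / α x) * g x v (T x) * f x) := by
  subst hgbar hg hf hα hα' hα'' hκ
  have hε' : ε * ε = 1 := by rcases hε with rfl | rfl <;> norm_num
  have hδ' : δ * δ = 1 := by rcases hδ with rfl | rfl <;> norm_num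
  have h := isFlatHypersurface hε' hδ' ha ha_pos hχ hν
  have hcov := fun V x => mvfderiv_toFlat_covDerivAlong hε' hδ' ha ha_pos hχ hν (V := V) (x := x)
  have hinj := mvfderiv_toFlat_injective hδ' hχ hν
  have hχd : ∀ x, MDifferentiableAt (𝓡 n) (𝓘(ℝ, ℝ).prod (𝓡 n)) χ x := fun x =>
    (hχ.smooth x).mdifferentiableAt (by simp)
  have hνd := fun x => SmoothAlongAt.mdifferentiableAt_principalPart (hν.smooth x)
  -- The next three facts restate the definitions of `A`, `T` and `f` through products in the flat
  -- space, the form in which the structure equations take them.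
  have hA' : ∀ x v w, pullbackMetric (𝓡 n) (warpedMetric ε I₀ a (SpaceForm.metric n k c)) χ x
      (A x v) w = -flatWarped (ambientForm n k c) ε a (toFlat (χ x))
        (flatCov (𝓡 n) (ambientForm n k c) (signR c) ε a (fun y => toFlat (χ y))
          (fun y => mvfderiv (𝓘(ℝ, ℝ).prod (𝓡 n)) toFlat (χ y) (ν y)) x v)
        (mvfderiv (𝓡 n) (fun y => toFlat (χ y)) x w) := by
    intro x v w
    rw [hA, shapeOperator, hχ.metric_tangentialPart, map_neg, neg_apply, warpedMetric_eq,
      hcov ν x (hνd x), mvfderiv_toFlat_comp (hχd x)]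
  have hT' : ∀ x w, pullbackMetric (𝓡 n) (warpedMetric ε I₀ a (SpaceForm.metric n k c)) χ x
      (T x) w = ε * (mvfderiv (𝓡 n) (fun y => toFlat (χ y)) x w).1 := by
    intro x w
    rw [hT, hχ.metric_tangentialPart, warpedMetric_eq, mvfderiv_toFlat_dt, flatWarped_dt,
      mvfderiv_toFlat_comp (hχd x)]
  have hf' : ∀ x, δ * warpedMetric ε I₀ a (SpaceForm.metric n k c) (χ x) (dt (𝓡 n) (χ x)) (ν x)
      = δ * (ε * (mvfderiv (𝓘(ℝ, ℝ).prod (𝓡 n)) toFlat (χ x) (ν x)).1) := by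
    intro x
    rw [warpedMetric_eq, mvfderiv_toFlat_dt, flatWarped_dt]
  refine ⟨fun x => hinj x ?_, fun x v => hinj x ?_, fun x X Y Z W hX hY hZ =>
    h.gauss hA' hT' hX hY hZ (W x), fun x X Y hX hY => h.codazzi hA' hT' hf' hX hY,
    fun x v => hinj x ?_, fun x v => h.leviCivita_tangentialPart hA' hT' hf' x v,
    fun x v => h.mvfderiv_normalPart hA' hT' hf' x v⟩
  · rw [mvfderiv_toFlat_dt, map_add, map_smul, ← mvfderiv_toFlat_comp (hχd x)]
    exact h.dt_eq hT' hf' x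
  · rw [hcov ν x (hνd x), map_neg, ← mvfderiv_toFlat_comp (hχd x)]
    exact h.flatCov_normal hA' x v
  · rw [hcov _ x (mdifferentiableAt_principalPart_dt hε' hδ' ha ha_pos hχ hν x), map_smul, map_sub,
      map_smul, ← mvfderiv_toFlat_comp (hχd x)]
    simp only [mvfderiv_toFlat_dt]
    exact h.flatCov_dt hT' x v
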